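/- Fix an integer $k\ge 3$. For an integer $n\ge 1$ and $p\in(0,1]$ let $[n]_p$ be the random subset of $[n]=\{1,\dots,n\}$ that contains each element independently with probability $p$. Let $X=X_{k,n,p}$ be the number of arithmetic progressions of length $k$ in $[n]_p$, that is, the number of $k$-element subsets $\{a,a+d,\dots,a+(k-1)d\}\subseteq [n]_p$ with $d\ge 1$; in particular $X_{k,n,1}$ is the number of such progressions in $[n]$. Write $\mu=\mathbb{E}X$ and $$\Phi=\min\bigl\{\mu,\ \sqrt{\mu}\,\log(1/p)\bigr\}.$$ Then there are $n_0,b,B>0$, depending only on $k$, such that for all $n\ge n_0$, $p\in(0,1]$ and $\varepsilon>0$, $$\mathbf{1}_{\{1\le(1+\varepsilon)\mu\le X_{k,n,1}\}}\exp\bigl(-B\max\{1,\varepsilon^2\}\,\Phi\bigr)\ \le\ \mathbb{P}\bigl(X\ge(1+\varepsilon)\mu\bigr)\ \le\ \exp\bigl(-b\min\{\varepsilon^3,\varepsilon^{1/2}\}\,\Phi\bigr).$$ -/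

import Mathlib

open MeasureTheory ProbabilityTheory

noncomputable section

namespace RandomAP

/-- The `k`-element subsets of `[n] = {1, …, n}` that form an arithmetic progression
`{a, a + d, …, a + (k - 1) d}` with `d > 0`. -/
def progressions (k n : ℕ) : Finset (Finset ℕ) := by
  classical
  exact {e ∈ (Finset.Icc 1 n).powersetCard k |
    ∃ a d : ℕ, 0 < d ∧ e = (Finset.range k).image (fun i => a + i * d)}

/-- The number of `k`-term arithmetic progressions of `[n]` that are contained in the set `S`. -/
def count (k n : ℕ) (S : Set ℕ) : ℕ := by
  classical
  exact ((progressions k n).filter (fun e : Finset ℕ => ∀ x ∈ e, x ∈ S)).card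

/-- The law of the binomial random subset `[n]_p`: each element of `[n]` is included independently
with probability `p`, and nothing else is included. -/
def randomSubset (n : ℕ) (p : unitInterval) : Measure (Set ℕ) :=
  setBernoulli (Set.Icc 1 n) p

/-- The expectation `μ = 𝔼 X`, where `X` is the number of `k`-term arithmetic progressions
in `[n]_p`. -/
def mean (k n : ℕ) (p : unitInterval) : ℝ :=
  ∫ S, (count k n S : ℝ) ∂(randomSubset n p)

/-- The upper tail probability `ℙ(X ≥ (1 + ε) μ)`. -/
def upperTail (k n : ℕ) (p : unitInterval) (ε : ℝ) : ℝ :=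
  (randomSubset n p).real {S | (1 + ε) * mean k n p ≤ (count k n S : ℝ)}

/-- `Φ = min {μ, √μ log (1 / p)}`. -/
def Phi (k n : ℕ) (p : unitInterval) : ℝ :=
  min (mean k n p) (√(mean k n p) * Real.log (1 / (p : ℝ)))

end RandomAP

end

/-! The progressions form a `k`-uniform hypergraph on `[n]` with order `n²` edges and codegrees at
most `k²`; the upper bound uses nothing else. Write `ℓ = log (1 / p)`, so that for `p < 1` one has
`Φ = μ / R` with `R = max 1 (√μ / ℓ)`.

Upper bound. In a hypergraph of bounded codegree, take vertex-disjoint stars with at least `r` edges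
each, maximizing their total number `T` of edges. By `exists_starFamily_sparse`, deleting `O(T²)`
edges leaves maximum degree `O(r)`. Hence an excess of `εμ` edges forces one of two events. (a) A
subfamily of maximum degree `O(r)` has at least `(1 + ε/2)μ` edges. It contains many `s`-tuples of
disjoint edges with `s ≈ εμ / r`, while the expected number of such tuples is at most `μ ^ s`;
Markov's inequality gives `(1 + ε/4)⁻ˢ`. (b) Disjoint large stars carry at least a constant times
`√(εμ)` edges. A star with `j` edges has at least `(k - 1)j` vertices, and disjoint stars contribute
independent factors, so an exponential moment gives `exp (-c ℓ √(εμ))`. Taking `r` of order `max 1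
√ε * R` makes both bounds at most `exp (-c min {ε², √ε} Φ)` up to a constant factor. Where that
constant matters, Markov's inequality for `X` takes over; this turns `ε²` into `ε³`
(`le_exp_of_le_add`).

Lower bound. Planting an initial interval of length `O(√((1 + ε)μ))` in the random set costs `exp
(-C √((1 + ε)μ) ℓ)`. This suffices unless `Φ = μ` and `max {1, ε²} μ` is smaller than `√((1 + ε)μ)
ℓ`. Then `(1 + ε)μ` is polylogarithmic in `n`, and `X` is compared with a Poisson variable: there
are about `(N/2)^m / m!` generic families of `m = ⌈(1 + ε)μ⌉` progressions among all `N`, the events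
that one of them is exactly the set of progressions present are disjoint, and a Harris-type
inequality bounds each from below (`pow_mul_exp_le_binExp`). -/

noncomputable section

namespace RandomAP

/-! ### Expectations over a binomial random subset, and a Harris-type inequality -/

section BinomialSubset

open Finset
open scoped Finset

variable {α : Type*} [DecidableEq α]

/-- The expectation of `f` evaluated at a random subset of `V` containing each element of `V`
independently with probability `p`. -/
def binExp (V : Finset α) (p : ℝ) (f : Finset α → ℝ) : ℝ :=
  ∑ S ∈ V.powerset, p ^ #S * (1 - p) ^ #(V \ S) * f S

theorem binExp_empty (p : ℝ) (f : Finset α → ℝ) : binExp ∅ p f = f ∅ := by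
  simp [binExp]

theorem binExp_insert {V : Finset α} {v : α} (hv : v ∉ V) (p : ℝ) (f : Finset α → ℝ) :
    binExp (insert v V) p f =
      (1 - p) * binExp V p f + p * binExp V p (fun S => f (insert v S)) := by
  unfold binExp
  rw [Finset.sum_powerset_insert hv, Finset.mul_sum, Finset.mul_sum]
  congr 1
  · refine Finset.sum_congr rfl fun S hS => ?_
    have hvS : v ∉ S := fun h => hv (Finset.mem_powerset.1 hS h)
    rw [Finset.insert_sdiff_of_notMem _ hvS, Finset.card_insert_of_notMem (by simp [hv])]
    ring
  · refine Finset.sum_congr rfl fun S hS => ?_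
    have hvS : v ∉ S := fun h => hv (Finset.mem_powerset.1 hS h)
    have : insert v V \ insert v S = V \ S := by
      ext x; simp only [mem_sdiff, mem_insert]; grind
    rw [this, Finset.card_insert_of_notMem hvS]
    ring

theorem binExp_mono {V : Finset α} {p : ℝ} (h0 : 0 ≤ p) (h1 : p ≤ 1) {f g : Finset α → ℝ}
    (h : ∀ S ⊆ V, f S ≤ g S) : binExp V p f ≤ binExp V p g := by
  have := sub_nonneg.2 h1
  refine Finset.sum_le_sum fun S hS => ?_
  exact mul_le_mul_of_nonneg_left (h S (Finset.mem_powerset.1 hS)) (by positivity)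

theorem binExp_nonneg {V : Finset α} {p : ℝ} (h0 : 0 ≤ p) (h1 : p ≤ 1) {f : Finset α → ℝ}
    (h : ∀ S ⊆ V, 0 ≤ f S) : 0 ≤ binExp V p f := by
  have := sub_nonneg.2 h1
  exact Finset.sum_nonneg fun S hS =>
    mul_nonneg (by positivity) (h S (Finset.mem_powerset.1 hS))

theorem binExp_sum {ι : Type*} (V : Finset α) (p : ℝ) (s : Finset ι) (f : ι → Finset α → ℝ) :
    binExp V p (fun S => ∑ i ∈ s, f i S) = ∑ i ∈ s, binExp V p (f i) := by
  unfold binExp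
  rw [Finset.sum_comm]
  exact Finset.sum_congr rfl fun S _ => by rw [Finset.mul_sum]

theorem binExp_add (V : Finset α) (p : ℝ) (f g : Finset α → ℝ) :
    binExp V p (fun S => f S + g S) = binExp V p f + binExp V p g := by
  simp [binExp, mul_add, Finset.sum_add_distrib]

theorem binExp_const_mul (V : Finset α) (p c : ℝ) (f : Finset α → ℝ) :
    binExp V p (fun S => c * f S) = c * binExp V p f := by
  unfold binExp
  rw [Finset.mul_sum]
  exact Finset.sum_congr rfl fun S _ => by ring

theorem binExp_subset {V A : Finset α} (p : ℝ) (hA : A ⊆ V) :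
    binExp V p (fun S => if A ⊆ S then 1 else 0) = p ^ #A := by
  induction V using Finset.induction_on generalizing A with
  | empty => simp [binExp_empty, Finset.subset_empty.1 hA]
  | insert v V hv ih =>
    rw [binExp_insert hv]
    have key : ∀ S, (A ⊆ insert v S) = (A.erase v ⊆ S) := fun S => by
      rw [Finset.subset_insert_iff]
    simp only [key]
    rw [ih (Finset.subset_insert_iff.1 hA)]
    by_cases hvA : v ∈ A
    · have : binExp V p (fun S => if A ⊆ S then (1 : ℝ) else 0) = 0 := by
        refine Finset.sum_eq_zero fun S hS => ?_
        have hAS : ¬ A ⊆ S := fun h => hv (Finset.mem_powerset.1 hS (h hvA))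
        simp only [hAS, if_false, mul_zero]
      rw [this, ← Finset.card_erase_add_one hvA]
      ring
    · rw [Finset.erase_eq_of_notMem hvA, ih ((Finset.subset_insert_iff_of_notMem hvA).1 hA)]
      ring

theorem binExp_one (V : Finset α) (p : ℝ) : binExp V p (fun _ => 1) = 1 := by
  simpa using binExp_subset p (Finset.empty_subset V)

/-- Markov's inequality: if `c ≤ f` on an event, its probability is at most
`binExp V p f / c`. -/
theorem mul_binExp_indicator_le {V : Finset α} {p : ℝ} (h0 : 0 ≤ p) (h1 : p ≤ 1)
    {Q : Finset α → Prop} [DecidablePred Q] {f : Finset α → ℝ} {c : ℝ} (hf : ∀ S ⊆ V, 0 ≤ f S)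
    (h : ∀ S ⊆ V, Q S → c ≤ f S) :
    c * binExp V p (fun S => if Q S then 1 else 0) ≤ binExp V p f := by
  rw [← binExp_const_mul]
  refine binExp_mono h0 h1 fun S hS => ?_
  split_ifs with hQ
  · simpa using h S hS hQ
  · simpa using hf S hS

/-- As a function of `p` the left side is a product of nonnegative nonincreasing affine functions,
hence convex; the right side is its chord between `p = 0` and `p = 1`. -/
theorem prod_one_sub_mul_le {ι : Type*} (s : Finset ι) {p : ℝ} (h0 : 0 ≤ p) (h1 : p ≤ 1)
    {x : ι → ℝ} (hx0 : ∀ i, 0 ≤ x i) (hx1 : ∀ i, x i ≤ 1) :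
    ∏ i ∈ s, (1 - p * x i) ≤ 1 - p + p * ∏ i ∈ s, (1 - x i) := by
  classical
  induction s using Finset.induction_on with
  | empty => simp
  | insert i s hi ih =>
    rw [Finset.prod_insert hi, Finset.prod_insert hi]
    set Y := ∏ i ∈ s, (1 - x i)
    have hY : Y ≤ 1 := Finset.prod_le_one (fun i _ => sub_nonneg.2 (hx1 i))
      (fun i _ => by linarith [hx0 i])
    have hpx : 0 ≤ 1 - p * x i := by nlinarith [hx0 i, hx1 i]
    have h3 := mul_le_mul_of_nonneg_left ih hpx
    have h4 : 0 ≤ (p * x i) * ((1 - p) * (1 - Y)) :=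
      mul_nonneg (mul_nonneg h0 (hx0 i)) (mul_nonneg (by linarith) (by linarith))
    nlinarith

/-- A Harris-type inequality: conditionally on containing `U`, the events of not containing the
sets `B i` are positively correlated. -/
theorem pow_mul_prod_le_binExp {ι : Type*} (V : Finset α) {p : ℝ} (h0 : 0 ≤ p) (h1 : p ≤ 1)
    (s : Finset ι) (B : ι → Finset α) (U : Finset α) (hU : U ⊆ V) (hB : ∀ i ∈ s, B i ⊆ V) :
    p ^ #U * ∏ i ∈ s, (1 - p ^ #(B i \ U)) ≤
      binExp V p (fun S => if U ⊆ S ∧ ∀ i ∈ s, ¬ B i ⊆ S then 1 else 0) := by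
  induction V using Finset.induction_on generalizing U s B with
  | empty =>
    obtain rfl := Finset.subset_empty.1 hU
    rw [binExp_empty]
    by_cases h : s = ∅
    · simp [h]
    · obtain ⟨i, hi⟩ := Finset.nonempty_iff_ne_empty.2 h
      rw [Finset.prod_eq_zero hi (by simp [Finset.subset_empty.1 (hB i hi)])]
      simp only [mul_zero]
      split_ifs <;> norm_num
  | insert v V hv ih =>
    rw [binExp_insert hv]
    have hins : binExp V p (fun S => if U ⊆ insert v S ∧ ∀ i ∈ s, ¬ B i ⊆ insert v S
        then (1 : ℝ) else 0) = binExp V p (fun S => if U.erase v ⊆ S ∧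
          ∀ i ∈ s, ¬ (B i).erase v ⊆ S then 1 else 0) := by
      simp only [Finset.subset_insert_iff]
    rw [hins]
    have ih1 := ih s (fun i => (B i).erase v) (U.erase v) (Finset.subset_insert_iff.1 hU)
      (fun i hi => Finset.subset_insert_iff.1 (hB i hi))
    have hnn : 0 ≤ binExp V p (fun S => if U ⊆ S ∧ ∀ i ∈ s, ¬ B i ⊆ S then 1 else 0) :=
      binExp_nonneg h0 h1 fun S _ => by split_ifs <;> norm_num
    by_cases hvU : v ∈ U
    · have e1 : ∀ i, (B i).erase v \ U.erase v = B i \ U := fun i => by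
        ext x; simp only [mem_sdiff, mem_erase]; grind
      simp only [e1] at ih1
      rw [← Finset.card_erase_add_one hvU, pow_succ]
      have := mul_le_mul_of_nonneg_left ih1 h0
      nlinarith [mul_nonneg (sub_nonneg.2 h1) hnn]
    -- Omitting `v` settles every `B i` through `v`, so only the other sets remain; choosing `v`
    -- removes one point from those `B i`. The two branches recombine by `prod_one_sub_mul_le`.
    · rw [Finset.erase_eq_of_notMem hvU] at ih1 ⊢
      have hUV : U ⊆ V := (Finset.subset_insert_iff_of_notMem hvU).1 hU
      have ih2 := ih (s.filter (fun i => v ∉ B i)) B U hUV (fun i hi => by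
        rw [mem_filter] at hi
        exact (Finset.subset_insert_iff_of_notMem hi.2).1 (hB i hi.1))
      have e2 : binExp V p (fun S => if U ⊆ S ∧ ∀ i ∈ s, ¬ B i ⊆ S then (1 : ℝ) else 0) =
          binExp V p (fun S => if U ⊆ S ∧ ∀ i ∈ s.filter (fun i => v ∉ B i), ¬ B i ⊆ S
            then 1 else 0) := by
        refine Finset.sum_congr rfl fun S hS => ?_
        have hvS : v ∉ S := fun h => hv (Finset.mem_powerset.1 hS h)
        have : (U ⊆ S ∧ ∀ i ∈ s, ¬ B i ⊆ S) ↔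
            (U ⊆ S ∧ ∀ i ∈ s.filter (fun i => v ∉ B i), ¬ B i ⊆ S) := by
          simp only [mem_filter, and_imp]
          exact and_congr_right fun _ => forall₂_congr fun i _ =>
            ⟨fun h _ => h, fun h hBS => h (fun hvB => hvS (hBS hvB)) hBS⟩
        simp only [this]
      rw [e2]
      have hp0 : ∀ n : ℕ, 0 ≤ 1 - p ^ n := fun n => sub_nonneg.2 (pow_le_one₀ h0 h1)
      set P₁ := ∏ i ∈ s.filter (fun i => v ∉ B i), (1 - p ^ #(B i \ U))
      have hP1 : 0 ≤ P₁ := Finset.prod_nonneg fun i _ => hp0 _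
      have split1 : ∏ i ∈ s, (1 - p ^ #(B i \ U)) =
          P₁ * ∏ i ∈ s.filter (fun i => ¬ v ∉ B i), (1 - p * p ^ #((B i).erase v \ U)) := by
        rw [← Finset.prod_filter_mul_prod_filter_not s (fun i => v ∉ B i)]
        congr 1
        refine Finset.prod_congr rfl fun i hi => ?_
        have hvB : v ∈ B i := by simpa using (mem_filter.1 hi).2
        rw [← pow_succ', Finset.erase_sdiff_comm, Finset.card_erase_add_one (by simp [hvB, hvU])]
      have split2 : ∏ i ∈ s, (1 - p ^ #((B i).erase v \ U)) =
          P₁ * ∏ i ∈ s.filter (fun i => ¬ v ∉ B i), (1 - p ^ #((B i).erase v \ U)) := by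
        rw [← Finset.prod_filter_mul_prod_filter_not s (fun i => v ∉ B i)]
        congr 1
        refine Finset.prod_congr rfl fun i hi => ?_
        rw [Finset.erase_eq_of_notMem (mem_filter.1 hi).2]
      rw [split1]
      rw [split2] at ih1
      have key := prod_one_sub_mul_le (s.filter (fun i => ¬ v ∉ B i)) h0 h1
        (x := fun i => p ^ #((B i).erase v \ U)) (fun i => by positivity)
        (fun i => pow_le_one₀ h0 h1)
      set Z := ∏ i ∈ s.filter (fun i => ¬ v ∉ B i), (1 - p ^ #((B i).erase v \ U))
      have hpU : 0 ≤ p ^ #U * P₁ := by positivity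
      have a1 := mul_le_mul_of_nonneg_left key hpU
      have a2 := mul_le_mul_of_nonneg_left ih1 h0
      have a3 := mul_le_mul_of_nonneg_left ih2 (sub_nonneg.2 h1)
      calc _ = p ^ #U * P₁ * ∏ i ∈ s.filter (fun i => ¬ v ∉ B i),
            (1 - p * p ^ #((B i).erase v \ U)) := by ring
        _ ≤ _ := a1
        _ = (1 - p) * (p ^ #U * P₁) + p * (p ^ #U * (P₁ * Z)) := by ring
        _ ≤ _ := add_le_add a3 a2

end BinomialSubset

/-- The law is carried by the finitely many subsets of `[n]`, so the integral is a sum over atoms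
and `f` needs no measurability. -/
theorem integral_randomSubset (n : ℕ) (p : unitInterval) (f : Set ℕ → ℝ) :
    ∫ S, f S ∂(randomSubset n p) = binExp (Finset.Icc 1 n) p (fun S => f S) := by
  have hfin : (Set.Icc 1 n).Finite := Set.finite_Icc 1 n
  let e : Finset ℕ ↪ Set ℕ := ⟨fun S => (S : Set ℕ), Finset.coe_injective⟩
  let P : Finset (Set ℕ) := (Finset.Icc 1 n).powerset.map e
  have hP : ∀ᵐ S ∂(randomSubset n p), S ∈ (P : Set (Set ℕ)) := by
    filter_upwards [setBernoulli_ae_subset (u := Set.Icc 1 n) (p := p)] with S hS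
    have hf : S.Finite := hfin.subset hS
    simp only [P, e, Finset.coe_map, Set.mem_image, Finset.mem_coe, Finset.mem_powerset,
      Function.Embedding.coeFn_mk]
    refine ⟨hf.toFinset, fun x hx => ?_, by simp⟩
    simpa using hS (by simpa using hx)
  have : IsProbabilityMeasure (randomSubset n p) := by unfold randomSubset; infer_instance
  rw [← setIntegral_univ, ← setIntegral_congr_set (ae_eq_univ.2 hP :
    (P : Set (Set ℕ)) =ᵐ[randomSubset n p] Set.univ)]
  rw [setIntegral_finset _ IntegrableOn.finset]
  simp only [P, Finset.sum_map, binExp]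
  refine Finset.sum_congr rfl fun S hS => ?_
  have hS' : (S : Set ℕ) ⊆ Set.Icc 1 n := by
    have := Finset.mem_powerset.1 hS
    rw [← Finset.coe_Icc]; exact_mod_cast this
  simp only [e, Function.Embedding.coeFn_mk, randomSubset]
  rw [setBernoulli_real_singleton p hS' hfin, ← Finset.coe_Icc, ← Finset.coe_sdiff,
    Set.ncard_coe_finset, Set.ncard_coe_finset, smul_eq_mul]

/-! ### Sparse subfamilies: moments counted by disjoint tuples -/

section SparseSubfamilies

open Finset
open scoped Finset

variable {α : Type*} [DecidableEq α]

/-- The number of ordered `s`-tuples of pairwise disjoint members of `J`. -/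
def disjointTuples : ℕ → Finset (Finset α) → ℕ
  | 0, _ => 1
  | s + 1, J => ∑ e ∈ J, disjointTuples s (J.filter (Disjoint e))

theorem disjointTuples_mono (s : ℕ) {I J : Finset (Finset α)} (h : I ⊆ J) :
    disjointTuples s I ≤ disjointTuples s J := by
  induction s generalizing I J with
  | zero => rfl
  | succ s ih =>
    exact (Finset.sum_le_sum fun e _ => ih (Finset.filter_subset_filter _ h)).trans
      (Finset.sum_le_sum_of_subset h)

/-- Greedy choice: each chosen edge excludes at most `C` others, so at least `x` choices remain at
each of the `s` steps. The hypothesis is `x + (s - 1) * C ≤ #J` with the subtraction moved across.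
-/
theorem pow_le_disjointTuples (s : ℕ) {J : Finset (Finset α)} {C x : ℝ} (hx : 0 ≤ x) (hC0 : 0 ≤ C)
    (hC : ∀ e ∈ J, (#(J.filter (fun f => ¬ Disjoint e f)) : ℝ) ≤ C) (hJ : x + s * C ≤ #J + C) :
    x ^ s ≤ disjointTuples s J := by
  induction s generalizing J with
  | zero => simp [disjointTuples]
  | succ s ih =>
    push_cast at hJ
    have hstep : ∀ e ∈ J, x ^ s ≤ disjointTuples s (J.filter (Disjoint e)) := by
      intro e he
      refine ih (fun f hf => le_trans ?_ (hC f (mem_filter.1 hf).1)) ?_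
      · exact_mod_cast Finset.card_le_card
          (Finset.filter_subset_filter _ (Finset.filter_subset _ _))
      · have h1 := Finset.card_filter_add_card_filter_not (s := J) (Disjoint e)
        have h2 := hC e he
        have h3 : (#(J.filter (Disjoint e)) : ℝ) + #(J.filter (fun f => ¬ Disjoint e f)) = #J := by
          exact_mod_cast h1
        linarith
    have hJx : x ≤ #J := by nlinarith [(Nat.cast_nonneg s : (0 : ℝ) ≤ s)]
    calc x ^ (s + 1) = x * x ^ s := pow_succ' _ _
      _ ≤ #J * x ^ s := by gcongr
      _ = ∑ e ∈ J, x ^ s := by simp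
      _ ≤ ∑ e ∈ J, (disjointTuples s (J.filter (Disjoint e)) : ℝ) := Finset.sum_le_sum hstep
      _ = _ := by simp [disjointTuples]

/-- Disjoint edges appear independently, so each tuple has probability `p ^ (k * s)`. The set `A`
collects the edges already chosen, which lets the induction on `s` run. -/
theorem binExp_disjointTuples_le {V : Finset α} {p : ℝ} (h0 : 0 ≤ p) {k : ℕ}
    (s : ℕ) {H : Finset (Finset α)} (hV : ∀ e ∈ H, e ⊆ V) (hk : ∀ e ∈ H, #e = k)
    {A : Finset α} (hAV : A ⊆ V) (hA : ∀ e ∈ H, Disjoint A e) :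
    binExp V p (fun S => (if A ⊆ S then 1 else 0) * (disjointTuples s (H.filter (· ⊆ S)) : ℝ)) ≤
      p ^ #A * (#H * p ^ k) ^ s := by
  induction s generalizing H A with
  | zero => simpa [disjointTuples] using (binExp_subset p hAV).le
  | succ s ih =>
    have expand : (fun S : Finset α => (if A ⊆ S then 1 else 0) *
        (disjointTuples (s + 1) (H.filter (· ⊆ S)) : ℝ)) = fun S => ∑ e ∈ H,
          (if A ∪ e ⊆ S then 1 else 0) *
            (disjointTuples s ((H.filter (Disjoint e)).filter (· ⊆ S)) : ℝ) := by
      funext S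
      simp only [disjointTuples, Nat.cast_sum, Finset.sum_filter, Finset.mul_sum]
      refine Finset.sum_congr rfl fun e he => ?_
      rw [Finset.filter_comm]
      by_cases h2 : e ⊆ S <;> by_cases h3 : A ⊆ S <;> simp [Finset.union_subset_iff, h2, h3]
    rw [expand, binExp_sum]
    have hterm : ∀ e ∈ H, binExp V p (fun S => (if A ∪ e ⊆ S then 1 else 0) *
        (disjointTuples s ((H.filter (Disjoint e)).filter (· ⊆ S)) : ℝ)) ≤
          p ^ #A * p ^ k * (#H * p ^ k) ^ s := by
      intro e he
      refine (ih (H := H.filter (Disjoint e)) (A := A ∪ e) (fun f hf => hV f (mem_filter.1 hf).1)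
        (fun f hf => hk f (mem_filter.1 hf).1) (Finset.union_subset hAV (hV e he))
        (fun f hf => Finset.disjoint_union_left.2
          ⟨hA f (mem_filter.1 hf).1, (mem_filter.1 hf).2⟩)).trans ?_
      rw [Finset.card_union_of_disjoint (hA e he), hk e he, pow_add]
      have : #(H.filter (Disjoint e)) ≤ #H := Finset.card_filter_le _ _
      gcongr
    refine (Finset.sum_le_sum hterm).trans (le_of_eq ?_)
    rw [Finset.sum_const, nsmul_eq_mul]
    ring

theorem card_filter_not_disjoint_le {k Δ : ℕ} {J : Finset (Finset α)}
    (hΔ : ∀ v, #(J.filter (v ∈ ·)) ≤ Δ) {e : Finset α} (he : #e = k) :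
    #(J.filter (fun f => ¬ Disjoint e f)) ≤ k * Δ := by
  have : J.filter (fun f => ¬ Disjoint e f) ⊆ e.biUnion (fun v => J.filter (v ∈ ·)) := by
    intro f hf
    rw [mem_filter, Finset.not_disjoint_iff] at hf
    obtain ⟨hf, v, hve, hvf⟩ := hf
    exact mem_biUnion.2 ⟨v, hve, mem_filter.2 ⟨hf, hvf⟩⟩
  refine (Finset.card_le_card this).trans ?_
  rw [← he]
  exact Finset.card_biUnion_le_card_mul _ _ _ fun v _ => hΔ v

open Classical in
/-- It is unlikely that the random hypergraph contains a large subfamily of small maximum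
degree. -/
theorem binExp_exists_sparse_le {V : Finset α} {p : ℝ} (h0 : 0 ≤ p) (h1 : p ≤ 1) {k : ℕ}
    {H : Finset (Finset α)} (hV : ∀ e ∈ H, e ⊆ V) (hk : ∀ e ∈ H, #e = k)
    {s Δ : ℕ} {x y : ℝ} (hx : 0 < x) (hxy : x + s * (k * Δ) ≤ y + k * Δ) :
    binExp V p (fun S => if ∃ I ⊆ H.filter (· ⊆ S), (∀ v, #(I.filter (v ∈ ·)) ≤ Δ) ∧ y ≤ #I
      then 1 else 0) ≤ (#H * p ^ k / x) ^ s := by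
  rw [div_pow, le_div_iff₀' (by positivity)]
  have hmom := binExp_disjointTuples_le h0 s hV hk (Finset.empty_subset V) (by simp)
  simp only [Finset.empty_subset, if_true, one_mul, card_empty, pow_zero] at hmom
  -- Markov's inequality for the number of disjoint `s`-tuples, a stand-in for the `s`-th moment: a
  -- sparse `I` alone supplies `x ^ s` of them.
  refine le_trans (mul_binExp_indicator_le h0 h1 (fun S _ => Nat.cast_nonneg _) ?_) hmom
  rintro S - ⟨I, hI, hΔ, hy⟩
  refine (pow_le_disjointTuples s hx.le (C := k * Δ) (by positivity) (fun e he => ?_) (by linarith)).trans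
    (by exact_mod_cast disjointTuples_mono s hI)
  exact_mod_cast card_filter_not_disjoint_le hΔ (hk e (mem_filter.1 (hI he)).1)

end SparseSubfamilies

/-! ### Disjoint stars and the deletion of high degrees -/

section Stars

open Finset
open scoped Finset

variable {α : Type*} [DecidableEq α]

/-- `(v, F)` is a star in `J` if `F` consists of members of `J` any two of which meet exactly in
the centre `v`. -/
def IsStar (J : Finset (Finset α)) (s : α × Finset (Finset α)) : Prop :=
  s.2 ⊆ J ∧ (∀ e ∈ s.2, s.1 ∈ e) ∧ ∀ e ∈ s.2, ∀ f ∈ s.2, e ≠ f → ∀ x ∈ e, x ∈ f → x = s.1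

/-- The set of vertices of a star. -/
def starVerts (s : α × Finset (Finset α)) : Finset α :=
  insert s.1 (s.2.biUnion id)

theorem mem_starVerts_self (s : α × Finset (Finset α)) : s.1 ∈ starVerts s :=
  mem_insert_self _ _

theorem IsStar.mono {β : Type*} {I J : Finset (Finset β)} {s : β × Finset (Finset β)} (h : IsStar I s)
    (hIJ : I ⊆ J) : IsStar J s :=
  ⟨h.1.trans hIJ, h.2⟩

/-- With the centre removed, the edges become pairwise disjoint sets of size `k - 1`. This makes
every edge of a star cost a factor `p ^ (k - 1)`. -/
theorem IsStar.le_card_starVerts {J : Finset (Finset α)} {k : ℕ} (hk : ∀ e ∈ J, #e = k)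
    {s : α × Finset (Finset α)} (h : IsStar J s) : (k - 1) * #s.2 ≤ #(starVerts s) := by
  have hsub : s.2.biUnion (fun e => e.erase s.1) ⊆ starVerts s := by
    intro x hx
    obtain ⟨e, he, hxe⟩ := mem_biUnion.1 hx
    exact mem_insert_of_mem (mem_biUnion.2 ⟨e, he, mem_of_mem_erase hxe⟩)
  refine le_trans (le_of_eq ?_) (Finset.card_le_card hsub)
  rw [Finset.card_biUnion]
  · rw [Finset.sum_congr rfl (fun e he => by
      rw [Finset.card_erase_of_mem (h.2.1 e he), hk e (h.1 he)]), Finset.sum_const, smul_eq_mul,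
      mul_comm]
  · intro e he f hf hef
    rw [Function.onFun, Finset.disjoint_left]
    intro x hxe hxf
    exact (mem_erase.1 hxe).1 (h.2.2 e he f hf hef x (mem_erase.1 hxe).2 (mem_erase.1 hxf).2)

theorem IsStar.card_starVerts_le {J : Finset (Finset α)} {k : ℕ} (hk : ∀ e ∈ J, #e = k)
    (hk0 : 0 < k) {s : α × Finset (Finset α)} (h : IsStar J s) (hs : 0 < #s.2) :
    #(starVerts s) ≤ 2 * k * #s.2 := by
  have h1 : #(s.2.biUnion id) ≤ #s.2 * k :=
    Finset.card_biUnion_le_card_mul _ _ _ fun e he => (hk e (h.1 he)).le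
  have h2 : #(starVerts s) ≤ #(s.2.biUnion id) + 1 := Finset.card_insert_le _ _
  nlinarith

/-- Greedy choice: by the codegree bound, at most `k * D` edges through `v` meet a given one in a
second vertex, that edge itself included. -/
theorem exists_star {J : Finset (Finset α)} {k D : ℕ} (hk : ∀ e ∈ J, #e = k) (hk2 : 2 ≤ k)
    (hD : ∀ x y, x ≠ y → #(J.filter (fun e => x ∈ e ∧ y ∈ e)) ≤ D) (hD0 : 0 < D) (v : α) (a : ℕ)
    {F : Finset (Finset α)} (hFJ : F ⊆ J) (hF : ∀ e ∈ F, v ∈ e) (ha : k * D * a ≤ #F) :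
    ∃ F' ⊆ F, IsStar F (v, F') ∧ #F' = a := by
  induction a generalizing F with
  | zero => exact ⟨∅, by simp, ⟨by simp, by simp, by simp⟩, rfl⟩
  | succ a ih =>
    have hkD : 0 < k * D := by positivity
    obtain ⟨e, he⟩ : F.Nonempty := by
      rw [← Finset.card_pos]
      exact lt_of_lt_of_le (by positivity) ha
    let F₂ := F.filter (fun f => ∀ x ∈ e, x ∈ f → x = v)
    have hcompl : F.filter (fun f => ¬ ∀ x ∈ e, x ∈ f → x = v) ⊆
        (e.erase v).biUnion (fun x => J.filter (fun f => x ∈ f ∧ v ∈ f)) := by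
      intro f hf
      rw [mem_filter] at hf
      push Not at hf
      obtain ⟨hfF, x, hxe, hxf, hxv⟩ := hf
      exact mem_biUnion.2 ⟨x, mem_erase.2 ⟨hxv, hxe⟩, mem_filter.2 ⟨hFJ hfF, hxf, hF f hfF⟩⟩
    have hcard : #(F.filter (fun f => ¬ ∀ x ∈ e, x ∈ f → x = v)) ≤ k * D := by
      refine (Finset.card_le_card hcompl).trans ((Finset.card_biUnion_le_card_mul _ _ D
        fun x hx => hD x v (mem_erase.1 hx).1).trans ?_)
      exact Nat.mul_le_mul_right _ ((Finset.card_erase_le).trans (hk e (hFJ he)).le)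
    have hsplit := Finset.card_filter_add_card_filter_not (s := F)
      (fun f => ∀ x ∈ e, x ∈ f → x = v)
    have hF₂F : F₂ ⊆ F := Finset.filter_subset _ _
    obtain ⟨F', hF'₂, hstar, hF'a⟩ := ih (hF₂F.trans hFJ) (fun f hf => hF f (hF₂F hf))
      (by rw [Nat.mul_succ] at ha; change _ ≤ #(F.filter _); omega)
    have heF' : e ∉ F' := by
      intro h
      obtain ⟨x, hxe, hxv⟩ : ∃ x ∈ e, x ≠ v :=
        Finset.exists_mem_ne (by rw [hk e (hFJ he)]; omega) v
      exact hxv ((mem_filter.1 (hF'₂ h)).2 x hxe hxe)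
    refine ⟨insert e F', Finset.insert_subset he (hF'₂.trans hF₂F), ⟨?_, ?_, ?_⟩, ?_⟩
    · exact Finset.insert_subset he (hF'₂.trans hF₂F)
    · exact fun f hf => hF f (Finset.insert_subset he (hF'₂.trans hF₂F) hf)
    · intro f hf g hg hfg x hxf hxg
      rcases mem_insert.1 hf with hfe | hf' <;> rcases mem_insert.1 hg with hge | hg'
      · exact absurd (hfe.trans hge.symm) hfg
      · exact (mem_filter.1 (hF'₂ hg')).2 x (hfe ▸ hxf) hxg
      · exact (mem_filter.1 (hF'₂ hf')).2 x (hge ▸ hxg) hxf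
      · exact hstar.2.2 f hf' g hg' hfg x hxf hxg
    · rw [Finset.card_insert_of_notMem heF', hF'a]

/-- A family of pairwise vertex-disjoint stars in `J`, each with at least `r` edges. -/
def IsStarFamily (J : Finset (Finset α)) (r : ℕ) (𝒮 : Finset (α × Finset (Finset α))) : Prop :=
  (∀ s ∈ 𝒮, IsStar J s ∧ r ≤ #s.2) ∧ (𝒮 : Set (α × Finset (Finset α))).PairwiseDisjoint starVerts

theorem IsStarFamily.subset_product {J : Finset (Finset α)} {r : ℕ} (hr : 0 < r)
    {𝒮 : Finset (α × Finset (Finset α))} (h : IsStarFamily J r 𝒮) :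
    𝒮 ⊆ J.biUnion id ×ˢ J.powerset := by
  intro s hs
  obtain ⟨hst, hrs⟩ := h.1 s hs
  obtain ⟨e, he⟩ := Finset.card_pos.1 (hr.trans_le hrs)
  exact mem_product.2 ⟨mem_biUnion.2 ⟨e, hst.1 he, hst.2.1 e he⟩, mem_powerset.2 hst.1⟩

theorem IsStarFamily.insert {J : Finset (Finset α)} {r : ℕ} {𝒮 : Finset (α × Finset (Finset α))}
    (h : IsStarFamily J r 𝒮) {s : α × Finset (Finset α)} (hs : IsStar J s) (hrs : r ≤ #s.2)
    (hdisj : ∀ t ∈ 𝒮, Disjoint (starVerts s) (starVerts t)) :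
    IsStarFamily J r (insert s 𝒮) ∧ s ∉ 𝒮 := by
  refine ⟨⟨fun t ht => ?_, ?_⟩, fun hmem => ?_⟩
  · rcases mem_insert.1 ht with rfl | ht
    · exact ⟨hs, hrs⟩
    · exact h.1 t ht
  · rw [Finset.coe_insert]
    exact h.2.insert fun t ht _ => hdisj t ht
  · exact Finset.disjoint_left.1 (hdisj s hmem) (mem_starVerts_self s) (mem_starVerts_self s)

theorem IsStarFamily.subset {J : Finset (Finset α)} {r : ℕ} {𝒮 𝒯 : Finset (α × Finset (Finset α))}
    (h : IsStarFamily J r 𝒮) (hsub : 𝒯 ⊆ 𝒮) : IsStarFamily J r 𝒯 :=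
  ⟨fun s hs => h.1 s (hsub hs), h.2.subset (by exact_mod_cast hsub)⟩

/-- Every hypergraph of small codegree becomes a hypergraph of small maximum degree after the
removal of few edges, unless it contains many disjoint large stars. -/
theorem exists_starFamily_sparse {J : Finset (Finset α)} {k D r : ℕ} (hk : ∀ e ∈ J, #e = k)
    (hk2 : 2 ≤ k) (hD : ∀ x y, x ≠ y → #(J.filter (fun e => x ∈ e ∧ y ∈ e)) ≤ D) (hD0 : 0 < D)
    (hr : 0 < r) :
    ∃ 𝒮, IsStarFamily J r 𝒮 ∧ ∃ I ⊆ J, (∀ v, #(I.filter (v ∈ ·)) ≤ k * D * r) ∧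
      #J ≤ #I + 8 * k ^ 2 * D * (∑ s ∈ 𝒮, #s.2) ^ 2 := by
  classical
  -- The total number of edges is maximized, rather than the number of stars, so that both adding a
  -- star and exchanging one for a larger star are excluded.
  obtain ⟨𝒮, h𝒮mem, hmax⟩ := Finset.exists_max_image
    ((J.biUnion id ×ˢ J.powerset).powerset.filter (IsStarFamily J r)) (fun 𝒮 => ∑ s ∈ 𝒮, #s.2)
    ⟨∅, mem_filter.2 ⟨by simp, ⟨by simp, by simp⟩⟩⟩
  have h𝒮 : IsStarFamily J r 𝒮 := (mem_filter.1 h𝒮mem).2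
  have hmax' : ∀ 𝒯, IsStarFamily J r 𝒯 → ∑ s ∈ 𝒯, #s.2 ≤ ∑ s ∈ 𝒮, #s.2 := fun 𝒯 h =>
    hmax 𝒯 (mem_filter.2 ⟨mem_powerset.2 (h.subset_product hr), h⟩)
  set T := ∑ s ∈ 𝒮, #s.2 with hT
  let W := 𝒮.biUnion starVerts
  have hsubW : ∀ t ∈ 𝒮, starVerts t ⊆ W := fun t ht => Finset.subset_biUnion_of_mem starVerts ht
  refine ⟨𝒮, h𝒮, J.filter (Disjoint W), Finset.filter_subset _ _, fun v => ?_, ?_⟩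
  · by_contra! hcon
    obtain ⟨F, hF, hstar, hcard⟩ := exists_star hk hk2 hD hD0 v r
      (F := (J.filter (Disjoint W)).filter (v ∈ ·))
      ((Finset.filter_subset _ _).trans (Finset.filter_subset _ _))
      (fun e he => (mem_filter.1 he).2) hcon.le
    have hFW : Disjoint (starVerts (v, F)) W := by
      have hne : F.Nonempty := by rw [← Finset.card_pos, hcard]; exact hr
      obtain ⟨e, he⟩ := hne
      rw [Finset.disjoint_left]
      intro x hx hxW
      rcases mem_insert.1 hx with rfl | hx
      · have h1 := mem_filter.1 (hF he)
        exact Finset.disjoint_left.1 (mem_filter.1 h1.1).2 hxW h1.2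
      · obtain ⟨f, hf, hxf⟩ := mem_biUnion.1 hx
        exact Finset.disjoint_left.1 (mem_filter.1 (mem_filter.1 (hF hf)).1).2 hxW hxf
    obtain ⟨hfam, hnot⟩ := h𝒮.insert (s := (v, F))
      (hstar.mono ((Finset.filter_subset _ _).trans (Finset.filter_subset _ _))) hcard.ge
      fun t ht => hFW.mono_right (hsubW t ht)
    have := hmax' _ hfam
    rw [Finset.sum_insert hnot] at this
    simp only [hcard] at this
    omega
  -- Edges meeting `W` in two vertices are counted by codegree, the others by `E`. If `E w` were
  -- large for some `w` in a star `s`, it would contain a star at `w` with `#s.2 + 1` edges; this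
  -- avoids all stars but `s`, and replacing `s` by it would contradict maximality.
  · let E : α → Finset (Finset α) := fun w => J.filter (fun e => w ∈ e ∧ ∀ x ∈ e, x ∈ W → x = w)
    have hE : ∀ s ∈ 𝒮, ∀ w ∈ starVerts s, #(E w) ≤ k * D * (#s.2 + 1) := by
      intro s hs w hw
      by_contra! hcon
      obtain ⟨F, hF, hstar, hcard⟩ := exists_star hk hk2 hD hD0 w (#s.2 + 1)
        (F := E w) (Finset.filter_subset _ _) (fun e he => (mem_filter.1 he).2.1) hcon.le
      have hFW : ∀ x ∈ starVerts (w, F), x ∈ W → x = w := by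
        intro x hx hxW
        rcases mem_insert.1 hx with rfl | hx
        · rfl
        · obtain ⟨f, hf, hxf⟩ := mem_biUnion.1 hx
          exact (mem_filter.1 (hF hf)).2.2 x hxf hxW
      obtain ⟨hfam, hnot⟩ := (h𝒮.subset (Finset.erase_subset s 𝒮)).insert (s := (w, F))
        (hstar.mono (Finset.filter_subset _ _)) (by rw [hcard]; have := (h𝒮.1 s hs).2; omega)
        (fun t ht => by
          obtain ⟨hts, ht⟩ := mem_erase.1 ht
          rw [Finset.disjoint_left]
          intro x hx hxt
          obtain rfl := hFW x hx (hsubW t ht hxt)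
          exact Finset.disjoint_left.1 (h𝒮.2 ht hs hts) hxt hw)
      have := hmax' _ hfam
      rw [Finset.sum_insert hnot] at this
      have h2 := Finset.add_sum_erase 𝒮 (fun s => #s.2) hs
      simp only [hcard] at this h2
      omega
    have hcover : J.filter (fun e => ¬ Disjoint W e) ⊆
        (W.offDiag.biUnion fun z => J.filter (fun e => z.1 ∈ e ∧ z.2 ∈ e)) ∪
          𝒮.biUnion (fun s => (starVerts s).biUnion E) := by
      intro e he
      rw [mem_filter, Finset.not_disjoint_iff] at he
      obtain ⟨heJ, w, hwW, hwe⟩ := he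
      rw [mem_union]
      by_cases h : ∀ x ∈ e, x ∈ W → x = w
      · right
        obtain ⟨s, hs, hws⟩ := mem_biUnion.1 hwW
        exact mem_biUnion.2 ⟨s, hs, mem_biUnion.2 ⟨w, hws, mem_filter.2 ⟨heJ, hwe, h⟩⟩⟩
      · left
        push Not at h
        obtain ⟨x, hxe, hxW, hxw⟩ := h
        exact mem_biUnion.2 ⟨(x, w), mem_offDiag.2 ⟨hxW, hwW, hxw⟩, mem_filter.2 ⟨heJ, hxe, hwe⟩⟩
    have hpos : ∀ s ∈ 𝒮, 0 < #s.2 := fun s hs => hr.trans_le (h𝒮.1 s hs).2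
    have hverts : ∀ s ∈ 𝒮, #(starVerts s) ≤ 2 * k * #s.2 := fun s hs =>
      (h𝒮.1 s hs).1.card_starVerts_le hk (by omega) (hpos s hs)
    have hW : #W ≤ 2 * k * T := by
      refine Finset.card_biUnion_le.trans ((Finset.sum_le_sum hverts).trans ?_)
      rw [hT, Finset.mul_sum]
    have c1 : #(W.offDiag.biUnion fun z => J.filter (fun e => z.1 ∈ e ∧ z.2 ∈ e)) ≤
        4 * k ^ 2 * D * T ^ 2 := by
      refine (Finset.card_biUnion_le_card_mul _ _ D fun z hz =>
        hD _ _ (mem_offDiag.1 hz).2.2).trans ?_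
      have h1 : #W.offDiag ≤ #W * #W := by rw [Finset.offDiag_card]; omega
      calc #W.offDiag * D ≤ (2 * k * T) * (2 * k * T) * D :=
            Nat.mul_le_mul_right _ (h1.trans (Nat.mul_le_mul hW hW))
        _ = _ := by ring
    have c2 : #(𝒮.biUnion (fun s => (starVerts s).biUnion E)) ≤ 4 * k ^ 2 * D * T ^ 2 := by
      refine Finset.card_biUnion_le.trans ?_
      have hterm : ∀ s ∈ 𝒮, #((starVerts s).biUnion E) ≤ 4 * k ^ 2 * D * T * #s.2 := by
        intro s hs
        refine (Finset.card_biUnion_le_card_mul _ _ _ (hE s hs)).trans ?_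
        have hsT : #s.2 ≤ T := Finset.single_le_sum (f := fun s => #s.2) (fun _ _ => Nat.zero_le _) hs
        calc #(starVerts s) * (k * D * (#s.2 + 1)) ≤ (2 * k * #s.2) * (k * D * (T + T)) := by
              gcongr
              · exact hverts s hs
              · exact (hpos s hs).trans_le hsT
          _ = _ := by ring
      refine (Finset.sum_le_sum hterm).trans (le_of_eq ?_)
      rw [← Finset.mul_sum, ← hT]
      ring
    have c3 := (Finset.card_le_card hcover).trans (Finset.card_union_le _ _)
    have c4 := Finset.card_filter_add_card_filter_not (s := J) (Disjoint W)
    have c5 : 8 * k ^ 2 * D * T ^ 2 = 4 * k ^ 2 * D * T ^ 2 + 4 * k ^ 2 * D * T ^ 2 := by ring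
    rw [c5]
    omega

end Stars

/-! ### The cost of large disjoint stars -/

section StarProbability

open Finset
open scoped Finset

variable {α : Type*} [DecidableEq α]

/-- An exponential moment bound for the number of edges in a family of disjoint stars. -/
theorem binExp_exists_starFamily_le
    {V : Finset α} {p : ℝ} (h0 : 0 ≤ p) (h1 : p ≤ 1) {k : ℕ}
    {H : Finset (Finset α)} (hV : ∀ e ∈ H, e ⊆ V) (hk : ∀ e ∈ H, #e = k) {r : ℕ} (hr : 0 < r)
    {θ T₀ : ℝ} (hθ : 0 ≤ θ) (Q : Finset α → Prop) [DecidablePred Q]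
    (hQ : ∀ S, Q S → ∃ 𝒮, IsStarFamily (H.filter (· ⊆ S)) r 𝒮 ∧ T₀ ≤ (∑ s ∈ 𝒮, #s.2 : ℕ)) :
    binExp V p (fun S => if Q S then 1 else 0) ≤ Real.exp (-(θ * T₀) +
      ∑ v ∈ V, ∑ F ∈ (H.filter (v ∈ ·)).powerset.filter (fun F => r ≤ #F),
        (p ^ (k - 1) * Real.exp θ) ^ #F) := by
  classical
  set y := p ^ (k - 1) * Real.exp θ with hy
  have hy0 : 0 ≤ y := by positivity
  let 𝒜 := (V ×ˢ H.powerset).filter (fun s => IsStar H s ∧ r ≤ #s.2)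
  let 𝓕 := 𝒜.powerset.filter (IsStarFamily H r)
  let U : Finset (α × Finset (Finset α)) → Finset α := fun 𝒮 => 𝒮.biUnion starVerts
  have hstarV : ∀ s ∈ 𝒜, starVerts s ⊆ V := by
    intro s hs
    obtain ⟨hs1, hs2, -⟩ := mem_filter.1 hs
    exact Finset.insert_subset (mem_product.1 hs1).1
      (Finset.biUnion_subset.2 fun e he => hV e (hs2.1 he))
  have hUV : ∀ 𝒮 ∈ 𝓕, U 𝒮 ⊆ V := fun 𝒮 h𝒮 => Finset.biUnion_subset.2 fun s hs =>
    hstarV s (mem_powerset.1 (mem_filter.1 h𝒮).1 hs)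
  have hmain : binExp V p (fun S => if Q S then 1 else 0) ≤ binExp V p (fun S => ∑ 𝒮 ∈ 𝓕,
      Real.exp (θ * ((∑ s ∈ 𝒮, #s.2 : ℕ) - T₀)) * (if U 𝒮 ⊆ S then 1 else 0)) := by
    refine binExp_mono h0 h1 fun S hS => ?_
    have hnn : ∀ 𝒮 ∈ 𝓕, 0 ≤ Real.exp (θ * ((∑ s ∈ 𝒮, #s.2 : ℕ) - T₀)) *
        (if U 𝒮 ⊆ S then (1 : ℝ) else 0) := fun 𝒮 _ => by split_ifs <;> positivity
    split_ifs with hQS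
    · obtain ⟨𝒮, h𝒮, hT⟩ := hQ S hQS
      have hHS : H.filter (· ⊆ S) ⊆ H := Finset.filter_subset _ _
      have hUS : U 𝒮 ⊆ S := by
        refine Finset.biUnion_subset.2 fun s hs => ?_
        have hsub : ∀ e ∈ s.2, e ⊆ S := fun e he => (mem_filter.1 ((h𝒮.1 s hs).1.1 he)).2
        obtain ⟨e, he⟩ := Finset.card_pos.1 (hr.trans_le (h𝒮.1 s hs).2)
        exact Finset.insert_subset (hsub e he ((h𝒮.1 s hs).1.2.1 e he))
          (Finset.biUnion_subset.2 hsub)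
      have hmem : 𝒮 ∈ 𝓕 := by
        refine mem_filter.2 ⟨mem_powerset.2 fun s hs => mem_filter.2
          ⟨mem_product.2 ⟨hS (hUS (mem_biUnion.2 ⟨s, hs, mem_starVerts_self s⟩)),
            mem_powerset.2 ((h𝒮.1 s hs).1.1.trans hHS)⟩, (h𝒮.1 s hs).1.mono hHS,
            (h𝒮.1 s hs).2⟩, fun s hs => ⟨(h𝒮.1 s hs).1.mono hHS, (h𝒮.1 s hs).2⟩, h𝒮.2⟩
      refine le_trans ?_ (Finset.single_le_sum hnn hmem)
      rw [if_pos hUS, mul_one]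
      exact Real.one_le_exp (mul_nonneg hθ (by linarith))
    · exact Finset.sum_nonneg hnn
  refine hmain.trans ?_
  rw [binExp_sum]
  have hterm : ∀ 𝒮 ∈ 𝓕, binExp V p (fun S => Real.exp (θ * ((∑ s ∈ 𝒮, #s.2 : ℕ) - T₀)) *
      (if U 𝒮 ⊆ S then 1 else 0)) ≤ Real.exp (-(θ * T₀)) * ∏ s ∈ 𝒮, y ^ #s.2 := by
    intro 𝒮 h𝒮
    obtain ⟨-, hfam⟩ := mem_filter.1 h𝒮
    rw [binExp_const_mul, binExp_subset p (hUV 𝒮 h𝒮)]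
    have hcard : (k - 1) * ∑ s ∈ 𝒮, #s.2 ≤ #(U 𝒮) := by
      rw [Finset.card_biUnion hfam.2, Finset.mul_sum]
      exact Finset.sum_le_sum fun s hs => (hfam.1 s hs).1.le_card_starVerts hk
    have hpow : p ^ #(U 𝒮) ≤ p ^ ((k - 1) * ∑ s ∈ 𝒮, #s.2) := pow_le_pow_of_le_one h0 h1 hcard
    rw [Finset.prod_pow_eq_pow_sum, hy, mul_pow, ← pow_mul, ← Real.exp_nat_mul, mul_sub,
      sub_eq_neg_add, Real.exp_add, mul_assoc]
    refine mul_le_mul_of_nonneg_left ?_ (Real.exp_pos _).le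
    rw [mul_comm, mul_comm θ]
    exact mul_le_mul_of_nonneg_right hpow (Real.exp_pos _).le
  refine (Finset.sum_le_sum hterm).trans ?_
  rw [← Finset.mul_sum, Real.exp_add]
  refine mul_le_mul_of_nonneg_left ?_ (Real.exp_pos _).le
  -- Disjointness has served its purpose of making the weights multiply. Forgetting it, the sum over
  -- families becomes a product over single stars.
  calc ∑ 𝒮 ∈ 𝓕, ∏ s ∈ 𝒮, y ^ #s.2 ≤ ∑ 𝒮 ∈ 𝒜.powerset, ∏ s ∈ 𝒮, y ^ #s.2 :=
        Finset.sum_le_sum_of_subset_of_nonneg (Finset.filter_subset _ _)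
          fun 𝒮 _ _ => Finset.prod_nonneg fun s _ => by positivity
    _ = ∏ s ∈ 𝒜, (1 + y ^ #s.2) := (Finset.prod_one_add _).symm
    _ ≤ ∏ s ∈ 𝒜, Real.exp (y ^ #s.2) := Finset.prod_le_prod (fun s _ => by positivity)
        fun s _ => by rw [add_comm]; exact Real.add_one_le_exp _
    _ = Real.exp (∑ s ∈ 𝒜, y ^ #s.2) := (Real.exp_sum _ _).symm
    _ ≤ _ := by
      refine Real.exp_le_exp.2 ?_
      -- Only the common centre is retained from the star condition, so that the sets `F` at a
      -- vertex can be counted by binomial coefficients.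
      let 𝒜' := (V ×ˢ H.powerset).filter (fun s => s.2 ⊆ H.filter (s.1 ∈ ·) ∧ r ≤ #s.2)
      have hsub : 𝒜 ⊆ 𝒜' := fun s hs => by
        obtain ⟨hs1, hs2, hs3⟩ := mem_filter.1 hs
        exact mem_filter.2 ⟨hs1, fun e he => mem_filter.2 ⟨hs2.1 he, hs2.2.1 e he⟩, hs3⟩
      refine (Finset.sum_le_sum_of_subset_of_nonneg hsub fun s _ _ => by positivity).trans
        (le_of_eq ?_)
      refine Finset.sum_finset_product 𝒜' V
        (fun v => (H.filter (v ∈ ·)).powerset.filter (fun F => r ≤ #F)) fun s => ?_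
      simp only [𝒜', mem_filter, mem_product, mem_powerset]
      exact ⟨fun h => ⟨h.1.1, h.2⟩,
        fun h => ⟨⟨h.1, h.2.1.trans (Finset.filter_subset _ _)⟩, h.2⟩⟩

/-- The sum over all large subsets of a small set is dominated by a geometric series. -/
theorem sum_powerset_pow_le {β : Type*} {J : Finset β} {d : ℝ} (hJ : (#J : ℝ) ≤ d) {r : ℕ}
    (hr : 0 < r) {y ρ : ℝ} (hy : 0 ≤ y) (hρ1 : ρ ≤ 1)
    (h : 2 * (Real.exp 1 * d * y) ≤ ρ * r) :
    ∑ F ∈ J.powerset.filter (fun F => r ≤ #F), y ^ #F ≤ ρ ^ r := by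
  classical
  have hd : 0 ≤ d := le_trans (Nat.cast_nonneg _) hJ
  have hr' : (0 : ℝ) < r := by exact_mod_cast hr
  have hρ0 : 0 ≤ ρ := by
    by_contra! hneg
    have : 0 ≤ 2 * (Real.exp 1 * d * y) := by positivity
    nlinarith
  -- From `C(d, j) ≤ (e d / j) ^ j` and `j ≥ r`, each factor is at most `ρ / 2`. The halves form the
  -- geometric series, which sums to at most `1` as `j ≥ r > 0`.
  have hchoose : ∀ j, r ≤ j → ((#J).choose j : ℝ) * y ^ j ≤ (1 / 2) ^ j * ρ ^ r := by
    intro j hj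
    have hj0 : (0 : ℝ) < j := by exact_mod_cast hr.trans_le hj
    have hrj : (r : ℝ) ≤ j := by exact_mod_cast hj
    have hfac : (0 : ℝ) < (j.factorial : ℝ) := by exact_mod_cast j.factorial_pos
    have e1 : ((#J).choose j : ℝ) ≤ d ^ j / j.factorial :=
      (Nat.choose_le_pow_div j #J).trans (by gcongr)
    have e2 : (j : ℝ) ^ j ≤ Real.exp 1 ^ j * j.factorial := by
      have := Real.pow_div_factorial_le_exp (j : ℝ) hj0.le j
      rwa [div_le_iff₀ hfac, ← Real.exp_one_pow] at this
    have e3 : d ^ j / j.factorial ≤ (Real.exp 1 * d / j) ^ j := by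
      rw [div_pow, mul_pow, div_le_div_iff₀ hfac (by positivity)]
      nlinarith [mul_le_mul_of_nonneg_left e2 (pow_nonneg hd j)]
    have e4 : Real.exp 1 * d / j * y ≤ 1 / 2 * ρ := by
      rw [div_mul_eq_mul_div, div_le_iff₀ hj0]
      nlinarith
    calc ((#J).choose j : ℝ) * y ^ j ≤ (Real.exp 1 * d / j) ^ j * y ^ j := by
          gcongr; exact e1.trans e3
      _ = (Real.exp 1 * d / j * y) ^ j := (mul_pow _ _ _).symm
      _ ≤ (1 / 2 * ρ) ^ j := by gcongr
      _ = (1 / 2) ^ j * ρ ^ j := mul_pow _ _ _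
      _ ≤ _ := by gcongr ?_ * ?_; exact pow_le_pow_of_le_one hρ0 hρ1 hj
  have hsum : ∑ F ∈ J.powerset.filter (fun F => r ≤ #F), y ^ #F =
      ∑ j ∈ Finset.range (#J + 1), if r ≤ j then ((#J).choose j : ℝ) * y ^ j else 0 := by
    rw [Finset.sum_filter,
      Finset.sum_powerset_apply_card (fun j => if r ≤ j then y ^ j else 0)]
    refine Finset.sum_congr rfl fun j _ => ?_
    split_ifs <;> simp
  rw [hsum]
  calc _ ≤ ∑ j ∈ Finset.range (#J + 1), if j = 0 then 0 else (1 / 2 : ℝ) ^ j * ρ ^ r := by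
        refine Finset.sum_le_sum fun j _ => ?_
        split_ifs with h1 h2 h2
        · omega
        · exact hchoose j h1
        · rfl
        · positivity
    _ = (∑ j ∈ Finset.range (#J), (1 / 2 : ℝ) ^ j) * (1 / 2 * ρ ^ r) := by
        rw [Finset.sum_range_succ', Finset.sum_mul]
        simp only [Nat.add_eq_zero_iff, one_ne_zero, and_false, if_false, if_true, add_zero]
        exact Finset.sum_congr rfl fun j _ => by ring
    _ ≤ 2 * (1 / 2 * ρ ^ r) := by
        gcongr
        rw [geom_sum_eq (by norm_num)]
        have : (0 : ℝ) ≤ (1 / 2) ^ #J := by positivity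
        rw [div_le_iff_of_neg (by norm_num)]
        linarith
    _ = ρ ^ r := by ring

end StarProbability

/-! ### Splitting the upper tail event -/

section UpperTail

open Finset
open scoped Finset

variable {α : Type*} [DecidableEq α]

theorem card_filter_mem_le {V : Finset α} {H : Finset (Finset α)} (hV : ∀ e ∈ H, e ⊆ V) {k D : ℕ}
    (hk : ∀ e ∈ H, #e = k) (hk2 : 2 ≤ k)
    (hD : ∀ x y, x ≠ y → #(H.filter (fun e => x ∈ e ∧ y ∈ e)) ≤ D) (v : α) :
    #(H.filter (v ∈ ·)) ≤ #V * D := by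
  have hsub : H.filter (v ∈ ·) ⊆
      (V.erase v).biUnion (fun x => H.filter (fun e => x ∈ e ∧ v ∈ e)) := by
    intro e he
    obtain ⟨heH, hve⟩ := mem_filter.1 he
    obtain ⟨x, hxe, hxv⟩ : ∃ x ∈ e, x ≠ v := Finset.exists_mem_ne (by rw [hk e heH]; omega) v
    exact mem_biUnion.2 ⟨x, mem_erase.2 ⟨hxv, hV e heH hxe⟩, mem_filter.2 ⟨heH, hxe, hve⟩⟩
  refine (Finset.card_le_card hsub).trans ((Finset.card_biUnion_le_card_mul _ _ D
    fun x hx => hD x v (mem_erase.1 hx).1).trans ?_)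
  exact Nat.mul_le_mul_right _ Finset.card_erase_le

theorem binExp_card_filter {V : Finset α} {H : Finset (Finset α)} (hV : ∀ e ∈ H, e ⊆ V) {k : ℕ}
    (hk : ∀ e ∈ H, #e = k) (p : ℝ) :
    binExp V p (fun S => (#(H.filter (· ⊆ S)) : ℝ)) = #H * p ^ k := by
  have : (fun S : Finset α => (#(H.filter (· ⊆ S)) : ℝ)) =
      fun S => ∑ e ∈ H, if e ⊆ S then 1 else 0 := by
    funext S; simp
  rw [this, binExp_sum, Finset.sum_congr rfl fun e he => by rw [binExp_subset p (hV e he), hk e he]]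
  simp

/-- The upper tail event forces a large sparse subfamily or many edges in disjoint stars. -/
theorem upper_tail_le_add {V : Finset α} {p : ℝ} (h0 : 0 ≤ p) (h1 : p ≤ 1) {k D r s : ℕ}
    {H : Finset (Finset α)} (hV : ∀ e ∈ H, e ⊆ V) (hk : ∀ e ∈ H, #e = k) (hk2 : 2 ≤ k)
    (hD : ∀ x y, x ≠ y → #(H.filter (fun e => x ∈ e ∧ y ∈ e)) ≤ D) (hD0 : 0 < D) (hr : 0 < r)
    {μ ε θ T₀ ρ : ℝ} (hμ : μ = #H * p ^ k) (hμ0 : 0 < μ) (hε : 0 < ε) (hθ : 0 ≤ θ)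
    (hs : s * (k * (k * D * r : ℕ)) ≤ ε / 4 * μ + k * (k * D * r : ℕ))
    (hT₀ : 8 * k ^ 2 * D * T₀ ^ 2 ≤ ε / 2 * μ) (hρ1 : ρ ≤ 1)
    (hρ : 2 * (Real.exp 1 * (#V * D) * (p ^ (k - 1) * Real.exp θ)) ≤ ρ * r)
    (hn : #V * ρ ^ r ≤ 1) :
    binExp V p (fun S => if (1 + ε) * μ ≤ #(H.filter (· ⊆ S)) then 1 else 0) ≤
      (1 / (1 + ε / 4)) ^ s + Real.exp (-(θ * T₀) + 1) := by
  classical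
  let Q₁ : Finset α → Prop := fun S => ∃ I ⊆ H.filter (· ⊆ S),
    (∀ v, #(I.filter (v ∈ ·)) ≤ k * D * r) ∧ (1 + ε / 2) * μ ≤ #I
  let Q₂ : Finset α → Prop := fun S => ∃ 𝒮, IsStarFamily (H.filter (· ⊆ S)) r 𝒮 ∧
    T₀ ≤ (∑ s ∈ 𝒮, #s.2 : ℕ)
  have hsplit : ∀ S, (1 + ε) * μ ≤ #(H.filter (· ⊆ S)) → Q₁ S ∨ Q₂ S := by
    intro S hS
    have hHS : H.filter (· ⊆ S) ⊆ H := Finset.filter_subset _ _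
    obtain ⟨𝒮, h𝒮, I, hI, hdeg, hcard⟩ := exists_starFamily_sparse (J := H.filter (· ⊆ S))
      (fun e he => hk e (hHS he)) hk2 (fun x y hxy => (Finset.card_le_card
        (Finset.filter_subset_filter _ hHS)).trans (hD x y hxy)) hD0 hr
    by_cases hIcard : (1 + ε / 2) * μ ≤ #I
    · exact Or.inl ⟨I, hI, hdeg, hIcard⟩
    · refine Or.inr ⟨𝒮, h𝒮, ?_⟩
      set T := ∑ s ∈ 𝒮, #s.2
      have hcard' : (#(H.filter (· ⊆ S)) : ℝ) ≤ #I + 8 * k ^ 2 * D * (T : ℝ) ^ 2 := by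
        exact_mod_cast hcard
      have hlt : 8 * k ^ 2 * D * T₀ ^ 2 < 8 * k ^ 2 * D * (T : ℝ) ^ 2 := by
        push Not at hIcard
        linarith
      have hlt2 : T₀ ^ 2 < (T : ℝ) ^ 2 := lt_of_mul_lt_mul_left hlt (by positivity)
      exact (lt_of_pow_lt_pow_left₀ 2 (Nat.cast_nonneg T) hlt2).le
  have hsum : binExp V p (fun S => if (1 + ε) * μ ≤ #(H.filter (· ⊆ S)) then 1 else 0) ≤
      binExp V p (fun S => if Q₁ S then 1 else 0) + binExp V p (fun S => if Q₂ S then 1 else 0) := by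
    rw [← binExp_add]
    refine binExp_mono h0 h1 fun S _ => ?_
    split_ifs with a b c c b c c <;> norm_num
    exact (hsplit S a).elim b c
  refine hsum.trans (add_le_add ?_ ?_)
  -- Of the excess `ε / 2`, one half pays for the edges excluded by the greedy choice; the other
  -- half gives the ratio `1 / (1 + ε / 4)`.
  · have hx : 0 < (1 + ε / 4) * μ := by positivity
    refine (binExp_exists_sparse_le h0 h1 hV hk (s := s) hx (by linarith)).trans (le_of_eq ?_)
    rw [← hμ]
    congr 1
    field_simp
  · refine (binExp_exists_starFamily_le h0 h1 hV hk hr hθ Q₂ fun S h => h).trans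
      (Real.exp_le_exp.2 (add_le_add le_rfl ?_))
    refine (Finset.sum_le_sum fun v _ => sum_powerset_pow_le (d := #V * D) ?_ hr ?_ hρ1 hρ).trans ?_
    · exact_mod_cast card_filter_mem_le hV hk hk2 hD v
    · positivity
    · simpa using hn

end UpperTail

/-! ### Numerical estimates for the choice of parameters -/

section Estimates

theorem min_mul_div_le {ε Φ μ R : ℝ} (hε : 0 < ε) (hR : 0 < R) (hμ : 0 ≤ μ)
    (hΦ : Φ * R ≤ μ) :
    min (ε ^ 2) (√ε) * Φ ≤ min 1 ε * (ε * μ / (max 1 (√ε) * R)) := by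
  have h1 : Φ ≤ μ / R := (le_div_iff₀ hR).2 hΦ
  have hM : 0 < max 1 (√ε) := lt_max_of_lt_left one_pos
  have h2 : min (ε ^ 2) (√ε) ≤ min 1 ε * (ε / max 1 (√ε)) := by
    rcases le_total ε 1 with h | h
    · rw [min_eq_right h, max_eq_left (Real.sqrt_le_one.2 h), div_one, ← sq]
      exact min_le_left _ _
    · rw [min_eq_left h, max_eq_right (Real.one_le_sqrt.2 h), one_mul, Real.div_sqrt]
      exact min_le_right _ _
  have h3 : 0 ≤ min (ε ^ 2) (√ε) := by positivity
  calc min (ε ^ 2) (√ε) * Φ ≤ min (ε ^ 2) (√ε) * (μ / R) := by gcongr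
    _ ≤ min 1 ε * (ε / max 1 (√ε)) * (μ / R) := by gcongr
    _ = _ := by field_simp

/-- If the exponent `c * A` is at least `4`, half of it absorbs the factor `1 + e ≤ e ^ 2`.
Otherwise only Markov's bound `1 / (1 + ε) ≤ exp (-min 1 ε / 2)` is available; its factor `min 1 ε`
is the reason for `ε ^ 3` in place of `ε ^ 2`. -/
theorem le_exp_of_le_add {P ε Φ c : ℝ} (hε : 0 < ε) (hc : 0 < c) (hΦ : 0 ≤ Φ)
    (hM : P ≤ 1 / (1 + ε))
    (hP : P ≤ Real.exp (-(c * (min (ε ^ 2) (√ε) * Φ))) +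
      Real.exp (-(c * (min (ε ^ 2) (√ε) * Φ)) + 1)) :
    P ≤ Real.exp (-(c / 8 * min (ε ^ 3) (√ε)) * Φ) := by
  set A := min (ε ^ 2) (√ε) * Φ with hA
  have hA0 : 0 ≤ A := by positivity
  have hA' : min (ε ^ 3) (√ε) * Φ ≤ min 1 ε * A := by
    rw [hA, ← mul_assoc]
    refine mul_le_mul_of_nonneg_right ?_ hΦ
    rcases le_total ε 1 with h | h
    · rw [min_eq_right h, mul_min_of_nonneg _ _ hε.le]
      have h1 : ε ≤ √ε := Real.le_sqrt_of_sq_le (by nlinarith)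
      refine le_min ((min_le_left _ _).trans_eq (by ring)) ((min_le_left _ _).trans ?_)
      nlinarith
    · rw [min_eq_left h, one_mul]
      have : ε ^ 2 ≥ √ε := by
        rw [ge_iff_le, Real.sqrt_le_left (by positivity)]
        nlinarith [pow_le_pow_left₀ zero_le_one h 3]
      rw [min_eq_right this]
      exact min_le_right _ _
  have hmin : min 1 ε ≤ 1 := min_le_left _ _
  have hmin0 : 0 ≤ min 1 ε := by positivity
  have hle : -(c / 8 * min 1 ε * A) ≤ -(c / 8 * min (ε ^ 3) (√ε)) * Φ := by
    nlinarith
  rcases le_total (c * A) 4 with h | h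
  · refine hM.trans ?_
    rw [one_div, ← Real.exp_log (show 0 < 1 + ε by linarith), ← Real.exp_neg]
    refine Real.exp_le_exp.2 (le_trans ?_ hle)
    have h1 := Real.one_sub_inv_le_log_of_pos (show 0 < 1 + ε by linarith)
    have h2 : min 1 ε / 2 ≤ 1 - (1 + ε)⁻¹ := by
      have : 1 - (1 + ε)⁻¹ = ε / (1 + ε) := by field_simp; ring
      rw [this, div_le_div_iff₀ two_pos (by linarith)]
      rcases le_total ε 1 with h | h
      · rw [min_eq_right h]; nlinarith
      · rw [min_eq_left h]; nlinarith
    nlinarith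
  · refine hP.trans (le_trans ?_ (Real.exp_le_exp.2 hle))
    rw [Real.exp_add]
    have e1 : Real.exp 1 < 3 := Real.exp_one_lt_three
    have e2 : (4 : ℝ) ≤ Real.exp 2 := by
      have := Real.add_one_le_exp (1 : ℝ)
      have h3 : Real.exp 2 = Real.exp 1 * Real.exp 1 := by rw [← Real.exp_add]; norm_num
      nlinarith
    calc Real.exp (-(c * A)) + Real.exp (-(c * A)) * Real.exp 1
        ≤ Real.exp (-(c * A)) * Real.exp 2 := by nlinarith [Real.exp_pos (-(c * A))]
      _ = Real.exp (-(c * A) + 2) := (Real.exp_add _ _).symm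
      _ ≤ _ := Real.exp_le_exp.2 (by nlinarith)

theorem min_div_five_le_log {ε : ℝ} (hε : 0 < ε) : min 1 ε / 5 ≤ Real.log (1 + ε / 4) := by
  refine le_trans ?_ (Real.one_sub_inv_le_log_of_pos (by positivity))
  have : 1 - (1 + ε / 4)⁻¹ = ε / (4 + ε) := by field_simp; ring
  rw [this, div_le_div_iff₀ (by norm_num) (by linarith)]
  rcases le_total ε 1 with h | h
  · rw [min_eq_right h]; nlinarith
  · rw [min_eq_left h]; nlinarith

/-- The exponents compare as `k - 1 - 1/8 ≥ 1/8 + 1/4 + k/2`, which holds exactly when `k ≥ 3`. The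
spare `exp (-(ℓ / 4))` compensates for the factor `ℓ` in the lower bound on `r * ℓ`. -/
theorem star_weight_le {k : ℕ} (hk : 3 ≤ k) {D n r ℓ g : ℝ} (hD : 0 ≤ D) (hn : 0 ≤ n)
    (hℓ : 0 < ℓ) (hg : 24 * D ≤ g) (h : g * (n * Real.exp (-(k / 2 * ℓ))) ≤ r * ℓ) :
    2 * (Real.exp 1 * (n * D) * (Real.exp (-ℓ) ^ (k - 1) * Real.exp (ℓ / 8))) ≤
      Real.exp (-(ℓ / 8)) * r := by
  have hsub : ((k - 1 : ℕ) : ℝ) = k - 1 := by rw [Nat.cast_sub (by omega)]; simp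
  have hk3' : (3 : ℝ) ≤ k := by exact_mod_cast hk
  have hexp : Real.exp (-ℓ) ^ (k - 1) * Real.exp (ℓ / 8) ≤
      Real.exp (-(ℓ / 8)) * (Real.exp (-(ℓ / 4)) * Real.exp (-(k / 2 * ℓ))) := by
    rw [← Real.exp_nat_mul, ← Real.exp_add, ← Real.exp_add, ← Real.exp_add, hsub]
    refine Real.exp_le_exp.2 ?_
    nlinarith
  have hℓexp : ℓ * Real.exp (-(ℓ / 4)) ≤ 4 := by
    have h1 := Real.add_one_le_exp (ℓ / 4)
    have h2 : Real.exp (ℓ / 4) * Real.exp (-(ℓ / 4)) = 1 := by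
      rw [← Real.exp_add, add_neg_cancel, Real.exp_zero]
    nlinarith [Real.exp_pos (-(ℓ / 4))]
  have e1 : Real.exp 1 ≤ 3 := Real.exp_one_lt_three.le
  set q := Real.exp (-(k / 2 * ℓ))
  set z := Real.exp (-(ℓ / 4))
  have hq : 0 < q := Real.exp_pos _
  have hz : 0 < z := Real.exp_pos _
  have hfin : 6 * D * n * (z * q) ≤ r := by
    refine le_of_mul_le_mul_right ?_ hℓ
    calc 6 * D * n * (z * q) * ℓ = 6 * D * (n * q) * (ℓ * z) := by ring
      _ ≤ 6 * D * (n * q) * 4 := by gcongr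
      _ = 24 * D * (n * q) := by ring
      _ ≤ g * (n * q) := by gcongr
      _ ≤ r * ℓ := h
  calc 2 * (Real.exp 1 * (n * D) * (Real.exp (-ℓ) ^ (k - 1) * Real.exp (ℓ / 8)))
      ≤ 2 * (3 * (n * D) * (Real.exp (-(ℓ / 8)) * (z * q))) := by gcongr
    _ = Real.exp (-(ℓ / 8)) * (6 * D * n * (z * q)) := by ring
    _ ≤ _ := by gcongr

/-- It suffices that `8 * log n ≤ r * ℓ`. If `log n ≤ 2 * k * ℓ`, the bound through `K` gives this;
otherwise `n * exp (-(k / 2 * ℓ))` is at least `log n / 2`. -/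
theorem mul_exp_pow_le_one {k r : ℕ} {n ℓ g K : ℝ} (hn : 1 ≤ n) (hℓ : 0 < ℓ) (hg : 24 ≤ g)
    (h : g * (n * Real.exp (-(k / 2 * ℓ))) ≤ r * ℓ) (hK : 16 * k ≤ K) (h' : K * ℓ ≤ r * ℓ) :
    n * Real.exp (-(ℓ / 8)) ^ r ≤ 1 := by
  obtain ⟨u, hu⟩ : ∃ u, u = Real.log n := ⟨_, rfl⟩
  have hu0 : 0 ≤ u := by rw [hu]; exact Real.log_nonneg hn
  have hVu : n = Real.exp u := by rw [hu, Real.exp_log (by linarith)]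
  suffices hsuff : 8 * u ≤ r * ℓ by
    rw [hVu, ← Real.exp_nat_mul, ← Real.exp_add]
    exact Real.exp_le_one_iff.2 (by linarith)
  rcases le_total u (2 * k * ℓ) with hle | hle
  · have : 16 * k * ℓ ≤ K * ℓ := by gcongr
    linarith
  · have h1 : u ≤ 2 * (n * Real.exp (-(k / 2 * ℓ))) := by
      rw [hVu, ← Real.exp_add]
      have h2 := Real.add_one_le_exp (u + -(k / 2 * ℓ))
      linarith
    have h3 : 24 * (n * Real.exp (-(k / 2 * ℓ))) ≤ g * (n * Real.exp (-(k / 2 * ℓ))) := by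
      gcongr
    linarith

end Estimates

/-! ### The upper bound for dense hypergraphs of bounded codegree -/

section UpperTail

open Finset
open scoped Finset

variable {α : Type*} [DecidableEq α]

set_option maxHeartbeats 1000000 in
/-- The upper bound on the upper tail for dense `k`-uniform hypergraphs of bounded codegree. -/
theorem upper_tail_le_exp {k D : ℕ} (hk3 : 3 ≤ k) (hD0 : 0 < D) {γ : ℝ} (hγ : 0 < γ) :
    ∃ b : ℝ, 0 < b ∧ ∀ (V : Finset α) (H : Finset (Finset α)), (∀ e ∈ H, e ⊆ V) →
      (∀ e ∈ H, #e = k) → (∀ x y, x ≠ y → #(H.filter (fun e => x ∈ e ∧ y ∈ e)) ≤ D) →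
      0 < #V → γ * (#V : ℝ) ^ 2 ≤ #H → ∀ ℓ : ℝ, 0 < ℓ → ∀ μ : ℝ, μ = #H * Real.exp (-ℓ) ^ k →
      ∀ ε : ℝ, 0 < ε →
      binExp V (Real.exp (-ℓ)) (fun S => if (1 + ε) * μ ≤ #(H.filter (· ⊆ S)) then 1 else 0) ≤
        Real.exp (-(b * min (ε ^ 3) (√ε)) * min μ (√μ * ℓ)) := by
  -- `16 * k` serves `mul_exp_pow_le_one`; `24 * D / √γ` serves `star_weight_le`, applied with `g =
  -- K * √γ`.
  obtain ⟨K, hK⟩ : ∃ K : ℝ, max (max 1 (16 * (k : ℝ))) (24 * D / √γ) ≤ K := ⟨_, le_rfl⟩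
  have hK1 : 1 ≤ K := (le_max_left _ _).trans ((le_max_left _ _).trans hK)
  have hKk : 16 * k ≤ K := (le_max_right _ _).trans ((le_max_left _ _).trans hK)
  have hγs : 0 < √γ := Real.sqrt_pos.2 hγ
  have hKD : 24 * D ≤ K * √γ := (div_le_iff₀ hγs).1 ((le_max_right _ _).trans hK)
  have hk0 : (0 : ℝ) < k := by exact_mod_cast (by omega : 0 < k)
  have hDpos : (0 : ℝ) < D := by exact_mod_cast hD0
  have hD1 : (1 : ℝ) ≤ D := by exact_mod_cast hD0
  -- The first entry comes from `s * log (1 + ε / 4)`, with `40 = 8 * 5`; the second from `θ * T₀ =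
  -- ℓ / 8 * (√(ε * μ) / (4 * k * D))`.
  obtain ⟨c, hc⟩ : ∃ c : ℝ, c = min (1 / (40 * (k : ℝ) ^ 2 * D * K)) (1 / (32 * (k : ℝ) * D)) := ⟨_, rfl⟩
  have hcpos : 0 < c := by rw [hc]; positivity
  have hc1 : c ≤ 1 / (40 * (k : ℝ) ^ 2 * D * K) := by rw [hc]; exact min_le_left _ _
  have hc2 : c ≤ 1 / (32 * (k : ℝ) * D) := by rw [hc]; exact min_le_right _ _
  refine ⟨c / 8, by positivity, ?_⟩
  intro V H hV hk hD hV0 hH ℓ hℓ μ hμ ε hε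
  have hn : (0 : ℝ) < #V := by exact_mod_cast hV0
  have hn1 : (1 : ℝ) ≤ #V := by exact_mod_cast hV0
  have hp1 : Real.exp (-ℓ) ≤ 1 := Real.exp_le_one_iff.2 (by linarith)
  have hHpos : (0 : ℝ) < #H := lt_of_lt_of_le (by positivity) hH
  have hμ0 : 0 < μ := by rw [hμ]; positivity
  have hμsq : √μ * √μ = μ := Real.mul_self_sqrt hμ0.le
  obtain ⟨R, hR⟩ : ∃ R : ℝ, R = max 1 (√μ / ℓ) := ⟨_, rfl⟩
  have hR1 : 1 ≤ R := by rw [hR]; exact le_max_left _ _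
  have hRμ : √μ ≤ R * ℓ := by rw [← div_le_iff₀ hℓ, hR]; exact le_max_right _ _
  obtain ⟨M, hM⟩ : ∃ M : ℝ, M = max 1 (√ε) := ⟨_, rfl⟩
  have hM1 : 1 ≤ M := by rw [hM]; exact le_max_left _ _
  have hΦR : min μ (√μ * ℓ) * R ≤ μ := by
    rw [hR]
    rcases le_total (√μ / ℓ) 1 with h | h
    · rw [max_eq_left h, mul_one]; exact min_le_left _ _
    · rw [max_eq_right h]
      calc _ ≤ √μ * ℓ * (√μ / ℓ) := by gcongr; exact min_le_right _ _
        _ = √μ * √μ := by field_simp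
        _ = μ := hμsq
  have hMR : 1 ≤ M * R := one_le_mul_of_one_le_of_one_le hM1 hR1
  have hKMR : 1 ≤ K * (M * R) := one_le_mul_of_one_le_of_one_le hK1 hMR
  obtain ⟨r, hr⟩ : ∃ r : ℕ, r = ⌈K * (M * R)⌉₊ := ⟨_, rfl⟩
  have hrlow : K * (M * R) ≤ r := by rw [hr]; exact Nat.le_ceil _
  have hrup : (r : ℝ) ≤ 2 * (K * (M * R)) := by
    rw [hr]; have := Nat.ceil_lt_add_one (show 0 ≤ K * (M * R) by linarith); linarith
  have hr0 : 0 < r := by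
    have : (0 : ℝ) < r := by linarith
    exact_mod_cast this
  have hRM : R ≤ M * R := le_mul_of_one_le_left (by linarith) hM1
  have hrR : K * R ≤ r := le_trans (by gcongr) hrlow
  have hrℓ : K * √μ ≤ r * ℓ := by
    calc K * √μ ≤ K * (R * ℓ) := by gcongr
      _ = K * R * ℓ := by ring
      _ ≤ r * ℓ := by gcongr
  have hrℓ2 : K * ℓ ≤ r * ℓ := by
    gcongr
    exact (le_mul_of_one_le_right (by linarith) hR1).trans hrR
  have hC : (0 : ℝ) < k * (k * D * r : ℕ) := by push_cast; positivity
  obtain ⟨s, hs⟩ : ∃ s : ℕ, s = ⌈ε / 4 * μ / (k * (k * D * r : ℕ))⌉₊ := ⟨_, rfl⟩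
  have hslow : ε / 4 * μ / (k * (k * D * r : ℕ)) ≤ s := by rw [hs]; exact Nat.le_ceil _
  have hsup : (s : ℝ) * (k * (k * D * r : ℕ)) ≤ ε / 4 * μ + k * (k * D * r : ℕ) := by
    have := (Nat.ceil_lt_add_one (show 0 ≤ ε / 4 * μ / (k * (k * D * r : ℕ)) by positivity)).le
    rw [← hs] at this
    calc (s : ℝ) * (k * (k * D * r : ℕ))
        ≤ (ε / 4 * μ / (k * (k * D * r : ℕ)) + 1) * (k * (k * D * r : ℕ)) := by gcongr
      _ = _ := by rw [add_mul, div_mul_cancel₀ _ hC.ne', one_mul]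
  have hμlow : √γ * #V * Real.exp (-(k / 2 * ℓ)) ≤ √μ := by
    refine Real.le_sqrt_of_sq_le ?_
    rw [mul_pow, mul_pow, Real.sq_sqrt hγ.le, hμ, ← Real.exp_nat_mul, ← Real.exp_nat_mul]
    refine mul_le_mul hH (Real.exp_le_exp.2 (by push_cast; linarith)) (Real.exp_pos _).le hHpos.le
  have hgr : K * √γ * (#V * Real.exp (-(k / 2 * ℓ))) ≤ r * ℓ :=
    calc _ = K * (√γ * #V * Real.exp (-(k / 2 * ℓ))) := by ring
      _ ≤ K * √μ := by gcongr
      _ ≤ r * ℓ := hrℓ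
  have hmain := upper_tail_le_add (V := V) (Real.exp_pos (-ℓ)).le hp1 (k := k) (D := D) (r := r)
    (s := s) (H := H) hV hk (by omega) hD hD0 hr0 (μ := μ) (ε := ε) (θ := ℓ / 8)
    (T₀ := √(ε * μ) / (4 * k * D)) (ρ := Real.exp (-(ℓ / 8))) hμ hμ0 hε (by positivity) hsup
    ?_ (Real.exp_le_one_iff.2 (by linarith)) ?_ ?_
  · refine le_exp_of_le_add hε hcpos (by positivity) ?_ (hmain.trans (add_le_add ?_ ?_))
    · rw [le_div_iff₀' (by positivity)]
      have := mul_binExp_indicator_le (V := V) (Real.exp_pos (-ℓ)).le hp1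
        (Q := fun S => (1 + ε) * μ ≤ #(H.filter (· ⊆ S))) (c := (1 + ε) * μ)
        (f := fun S => (#(H.filter (· ⊆ S)) : ℝ)) (fun _ _ => Nat.cast_nonneg _) (fun _ _ h => h)
      rw [binExp_card_filter hV hk, ← hμ, mul_right_comm] at this
      exact le_of_mul_le_mul_right (by linarith) hμ0
    · have hlog := min_div_five_le_log hε
      rw [one_div, ← Real.exp_log (show 0 < 1 + ε / 4 by positivity), ← Real.exp_neg,
        ← Real.exp_nat_mul]
      refine Real.exp_le_exp.2 ?_
      rw [mul_neg, neg_le_neg_iff]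
      have hs2 : ε * μ / (8 * k ^ 2 * D * K * (M * R)) ≤ s := by
        refine le_trans ?_ hslow
        push_cast
        calc ε * μ / (8 * k ^ 2 * D * K * (M * R))
            = ε / 4 * μ / (k * (k * D * (2 * (K * (M * R))))) := by field_simp; norm_num
          _ ≤ ε / 4 * μ / (k * (k * D * r)) := by gcongr
      calc c * (min (ε ^ 2) (√ε) * min μ (√μ * ℓ))
          ≤ 1 / (40 * k ^ 2 * D * K) * (min 1 ε * (ε * μ / (M * R))) := by
            refine mul_le_mul hc1 ?_ (by positivity) (by positivity)
            rw [hM]; exact min_mul_div_le hε (by linarith) hμ0.le hΦR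
        _ = ε * μ / (8 * k ^ 2 * D * K * (M * R)) * (min 1 ε / 5) := by field_simp; norm_num
        _ ≤ s * Real.log (1 + ε / 4) := by gcongr
    · refine Real.exp_le_exp.2 (add_le_add (neg_le_neg ?_) le_rfl)
      calc c * (min (ε ^ 2) (√ε) * min μ (√μ * ℓ)) ≤ 1 / (32 * k * D) * (√ε * (√μ * ℓ)) := by
            gcongr
            · exact min_le_right _ _
            · exact min_le_right _ _
        _ = _ := by rw [Real.sqrt_mul hε.le]; field_simp; norm_num
  · rw [div_pow, Real.sq_sqrt (by positivity)]
    calc 8 * (k : ℝ) ^ 2 * D * (ε * μ / (4 * k * D) ^ 2) = ε / 2 * μ / D := by field_simp; norm_num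
      _ ≤ ε / 2 * μ := div_le_self (by positivity) hD1
  · exact star_weight_le hk3 hDpos.le hn.le hℓ hKD hgr
  · exact mul_exp_pow_le_one hn1 hℓ (by linarith) hgr hKk hrℓ2

end UpperTail

/-! ### Arithmetic progressions as a hypergraph -/

section Progressions

open Finset
open scoped Finset

/-- The arithmetic progression `{a, a + d, …, a + (k - 1) d}`. -/
def progression (k a d : ℕ) : Finset ℕ := (Finset.range k).image (fun i => a + i * d)

theorem mem_progression {k a d x : ℕ} : x ∈ progression k a d ↔ ∃ i < k, a + i * d = x := by
  simp [progression]

theorem card_progression (k a : ℕ) {d : ℕ} (hd : 0 < d) : #(progression k a d) = k := by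
  rw [progression, Finset.card_image_of_injective, Finset.card_range]
  intro i j h
  exact Nat.eq_of_mul_eq_mul_right hd (Nat.add_left_cancel h)

theorem progression_injective {k a d a' d' : ℕ} (hk : 2 ≤ k) (hd : 0 < d) (hd' : 0 < d')
    (h : progression k a d = progression k a' d') : a = a' ∧ d = d' := by
  have key : ∀ {a d a' d' : ℕ}, progression k a d = progression k a' d' → a' ≤ a := by
    intro a d a' d' h
    have : a ∈ progression k a' d' := h ▸ mem_progression.2 ⟨0, by omega, by simp⟩
    obtain ⟨i, -, hi⟩ := mem_progression.1 this
    omega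
  obtain rfl : a = a' := le_antisymm (key h.symm) (key h)
  have key2 : ∀ {d d' : ℕ}, 0 < d → progression k a d = progression k a d' → d' ≤ d := by
    intro d d' hd h
    have : a + 1 * d ∈ progression k a d' := h ▸ mem_progression.2 ⟨1, by omega, rfl⟩
    obtain ⟨i, -, hi⟩ := mem_progression.1 this
    have hi0 : i ≠ 0 := by rintro rfl; omega
    have : 1 * d' ≤ i * d' := Nat.mul_le_mul_right _ (Nat.one_le_iff_ne_zero.2 hi0)
    omega
  exact ⟨rfl, le_antisymm (key2 hd' h.symm) (key2 hd h)⟩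

theorem mem_progressions {k n : ℕ} {e : Finset ℕ} : e ∈ progressions k n ↔
    e ⊆ Finset.Icc 1 n ∧ ∃ a d, 0 < d ∧ e = progression k a d := by
  simp only [progressions, mem_filter, mem_powersetCard, progression]
  refine ⟨fun h => ⟨h.1.1, h.2⟩, fun h => ⟨⟨h.1, ?_⟩, h.2⟩⟩
  obtain ⟨a, d, hd, rfl⟩ := h.2
  exact card_progression k a hd

theorem subset_of_mem_progressions {k n : ℕ} {e : Finset ℕ} (h : e ∈ progressions k n) :
    e ⊆ Finset.Icc 1 n :=
  (mem_progressions.1 h).1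

theorem card_of_mem_progressions {k n : ℕ} {e : Finset ℕ} (h : e ∈ progressions k n) :
    #e = k := by
  obtain ⟨a, d, hd, rfl⟩ := (mem_progressions.1 h).2
  exact card_progression k a hd

/-- The positions of `x` and `y` within a progression determine its first term and difference. -/
theorem codegree_progressions_le (k n : ℕ) {x y : ℕ} (hxy : x ≠ y) :
    #((progressions k n).filter (fun e => x ∈ e ∧ y ∈ e)) ≤ k ^ 2 := by
  have : #(Finset.range k ×ˢ Finset.range k) = k ^ 2 := by simp [sq]
  rw [← this]
  refine Finset.card_le_card_of_forall_subsingleton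
    (fun e z => ∃ a d, e = progression k a d ∧ a + z.1 * d = x ∧ a + z.2 * d = y) ?_ ?_
  · intro e he
    obtain ⟨heP, hx, hy⟩ := mem_filter.1 he
    obtain ⟨a, d, hd, rfl⟩ := (mem_progressions.1 heP).2
    obtain ⟨i, hi, hix⟩ := mem_progression.1 hx
    obtain ⟨j, hj, hjy⟩ := mem_progression.1 hy
    exact ⟨(i, j), by simp [hi, hj], a, d, rfl, hix, hjy⟩
  · rintro ⟨i, j⟩ - e ⟨-, a, d, rfl, hx, hy⟩ e' ⟨-, a', d', rfl, hx', hy'⟩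
    simp only at hx hy hx' hy'
    have hij : (i : ℤ) - j ≠ 0 := by
      intro h
      have : i = j := by omega
      exact hxy (by rw [← hx, ← hy, this])
    have h1 : (a : ℤ) + i * d = a' + i * d' := by exact_mod_cast hx.trans hx'.symm
    have h2 : (a : ℤ) + j * d = a' + j * d' := by exact_mod_cast hy.trans hy'.symm
    have h3 : ((i : ℤ) - j) * (d - d') = 0 := by linear_combination h1 - h2
    have h4 : (d : ℤ) = d' := sub_eq_zero.1 ((mul_eq_zero.1 h3).resolve_left hij)
    have h5 : d = d' := by exact_mod_cast h4
    subst h5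
    have h6 : a = a' := by omega
    rw [h6]

theorem card_progressions_le {k n : ℕ} (hk : 2 ≤ k) : #(progressions k n) ≤ n ^ 2 := by
  have hsub : progressions k n ⊆
      (Finset.Icc 1 n ×ˢ Finset.Icc 1 n).image (fun z => progression k z.1 z.2) := by
    intro e he
    obtain ⟨hsub, a, d, hd, rfl⟩ := mem_progressions.1 he
    have h1 := mem_Icc.1 (hsub (mem_progression.2 ⟨0, by omega, rfl⟩))
    have h2 := mem_Icc.1 (hsub (mem_progression.2 ⟨1, by omega, rfl⟩))
    refine mem_image.2 ⟨(a, d), ?_, rfl⟩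
    simp only [mem_product, mem_Icc]
    omega
  refine (Finset.card_le_card hsub).trans (Finset.card_image_le.trans ?_)
  simp [sq]

theorem count_coe (k n : ℕ) (S : Finset ℕ) :
    count k n S = #((progressions k n).filter (· ⊆ S)) := by
  unfold count
  congr 1
  ext e
  simp [Finset.subset_iff]

theorem count_Icc (k n : ℕ) : count k n (Set.Icc 1 n) = #(progressions k n) := by
  rw [← Finset.coe_Icc, count_coe, Finset.filter_true_of_mem]
  exact fun e he => subset_of_mem_progressions he

theorem half_div_le_cast_div {L m : ℕ} (hm : 0 < m) (h : m ≤ L) :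
    (L : ℝ) / (2 * m) ≤ (L / m : ℕ) := by
  have hm' : (0 : ℝ) < m := by exact_mod_cast hm
  rw [div_le_iff₀ (by positivity)]
  have h1 : 1 ≤ L / m := (Nat.one_le_div_iff hm).2 h
  have h2 := Nat.div_add_mod L m
  have h3 := Nat.mod_lt L hm
  have h4 : L ≤ (L / m) * (2 * m) := by nlinarith
  exact_mod_cast h4

/-- There are quadratically many progressions in an initial segment. -/
theorem sq_le_card_filter_subset_Icc {k n L : ℕ} (hk : 2 ≤ k) (hL : 2 * k ≤ L) (hLn : L ≤ n) :
    1 / (16 * k) * (L : ℝ) ^ 2 ≤ #((progressions k n).filter (· ⊆ Finset.Icc 1 L)) := by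
  -- First terms up to `L / 2` with differences up to `L / (2 * k)` stay inside. Each floor loses at
  -- most a factor two, whence `16 * k`.
  have hsub : (Finset.Icc 1 (L / 2) ×ˢ Finset.Icc 1 (L / (2 * k))).image
      (fun z => progression k z.1 z.2) ⊆ (progressions k n).filter (· ⊆ Finset.Icc 1 L) := by
    intro e he
    obtain ⟨⟨a, d⟩, hz, rfl⟩ := mem_image.1 he
    simp only [mem_product, mem_Icc] at hz
    have hL' : progression k a d ⊆ Finset.Icc 1 L := by
      intro x hx
      obtain ⟨i, hi, rfl⟩ := mem_progression.1 hx
      have h1 : i * d ≤ k * (L / (2 * k)) := Nat.mul_le_mul hi.le hz.2.2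
      have h2 : 2 * (k * (L / (2 * k))) ≤ L := by
        rw [← mul_assoc]; exact Nat.mul_div_le L (2 * k)
      rw [mem_Icc]
      omega
    refine mem_filter.2 ⟨mem_progressions.2 ⟨hL'.trans (Finset.Icc_subset_Icc_right hLn), a, d,
      by omega, rfl⟩, hL'⟩
  have hcard : #((Finset.Icc 1 (L / 2) ×ˢ Finset.Icc 1 (L / (2 * k))).image
      (fun z => progression k z.1 z.2)) = (L / 2) * (L / (2 * k)) := by
    rw [Finset.card_image_of_injOn, card_product, Nat.card_Icc, Nat.card_Icc]
    · simp
    · rintro ⟨a, d⟩ h ⟨a', d'⟩ h' heq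
      simp only [coe_product, Set.mem_prod, mem_coe, mem_Icc] at h h'
      obtain ⟨rfl, rfl⟩ := progression_injective hk (by omega) (by omega) heq
      rfl
  have h1 := half_div_le_cast_div (L := L) (m := 2) two_pos (by omega)
  have h2 := half_div_le_cast_div (L := L) (m := 2 * k) (by omega) hL
  have h3 : ((L / 2 : ℕ) : ℝ) * (L / (2 * k) : ℕ) ≤
      #((progressions k n).filter (· ⊆ Finset.Icc 1 L)) := by
    rw [← Nat.cast_mul, ← hcard]
    exact_mod_cast Finset.card_le_card hsub
  refine le_trans ?_ h3
  have hk0 : (0 : ℝ) < k := by exact_mod_cast (by omega : 0 < k)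
  calc 1 / (16 * k) * (L : ℝ) ^ 2 = L / (2 * (2 : ℕ)) * (L / (2 * (2 * k : ℕ))) := by
        push_cast; field_simp; ring
    _ ≤ _ := by gcongr

theorem sq_le_card_progressions {k n : ℕ} (hk : 2 ≤ k) (hn : 2 * k ≤ n) :
    1 / (16 * k) * (n : ℝ) ^ 2 ≤ #(progressions k n) :=
  (sq_le_card_filter_subset_Icc hk hn le_rfl).trans
    (by exact_mod_cast Finset.card_filter_le _ _)

theorem mean_eq (k n : ℕ) (p : unitInterval) :
    mean k n p = #(progressions k n) * (p : ℝ) ^ k := by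
  rw [mean, integral_randomSubset, ← binExp_card_filter (fun e => subset_of_mem_progressions)
    (fun e => card_of_mem_progressions)]
  simp only [count_coe]

theorem upperTail_eq (k n : ℕ) (p : unitInterval) (ε : ℝ) :
    upperTail k n p ε = binExp (Finset.Icc 1 n) p (fun S =>
      if (1 + ε) * mean k n p ≤ #((progressions k n).filter (· ⊆ S)) then 1 else 0) := by
  classical
  have : upperTail k n p ε = ∫ S, (if (1 + ε) * mean k n p ≤ (count k n S : ℝ) then 1 else 0)
      ∂(randomSubset n p) := by
    set E : Set (Set ℕ) := {S | (1 + ε) * mean k n p ≤ (count k n S : ℝ)}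
    -- Measurability is needed only for the trace of the event on the subsets of `[n]`, which is
    -- finite.
    have hfin : {S ∈ E | S ⊆ Set.Icc 1 n}.Finite :=
      (Set.finite_Icc 1 n).finite_subsets.subset fun S hS => hS.2
    rw [upperTail, measureReal_def, randomSubset, setBernoulli_apply_eq_apply_subsets,
      ← measureReal_def, ← integral_indicator_one hfin.measurableSet]
    refine integral_congr_ae ?_
    filter_upwards [setBernoulli_ae_subset (u := Set.Icc 1 n) (p := p)] with S hS
    simp [Set.indicator_apply, E, hS]
  rw [this, integral_randomSubset]
  simp only [count_coe]

/-- The upper bound of the main theorem. -/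
theorem exists_upperTail_le (k : ℕ) (hk : 3 ≤ k) : ∃ b : ℝ, 0 < b ∧ ∀ n : ℕ, 2 * k ≤ n →
    ∀ p : unitInterval, 0 < (p : ℝ) → ∀ ε : ℝ, 0 < ε →
      upperTail k n p ε ≤ Real.exp (-(b * min (ε ^ 3) (√ε)) * Phi k n p) := by
  have hk0 : (0 : ℝ) < k := by exact_mod_cast (by omega : 0 < k)
  obtain ⟨b, hb, hbound⟩ := upper_tail_le_exp (α := ℕ) hk (D := k ^ 2) (by positivity)
    (γ := 1 / (16 * k)) (by positivity)
  refine ⟨b, hb, fun n hn p hp ε hε => ?_⟩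
  rcases p.2.2.eq_or_lt with h1 | h1
  · have hΦ : Phi k n p = 0 := by
      rw [Phi, h1, div_one, Real.log_one, mul_zero]
      exact min_eq_right (by rw [mean_eq]; positivity)
    rw [hΦ, mul_zero, Real.exp_zero, upperTail_eq]
    refine (binExp_mono p.2.1 p.2.2 (g := fun _ => 1) fun S _ => ?_).trans_eq (binExp_one _ _)
    split_ifs <;> norm_num
  · obtain ⟨ℓ, hℓ⟩ : ∃ ℓ, ℓ = Real.log (1 / (p : ℝ)) := ⟨_, rfl⟩
    have hℓ0 : 0 < ℓ := by rw [hℓ]; exact Real.log_pos (one_lt_one_div hp h1)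
    have hpℓ : (p : ℝ) = Real.exp (-ℓ) := by rw [hℓ, one_div, Real.log_inv, neg_neg, Real.exp_log hp]
    have := hbound (Finset.Icc 1 n) (progressions k n) (fun e => subset_of_mem_progressions)
      (fun e => card_of_mem_progressions) (fun x y hxy => codegree_progressions_le k n hxy)
      (by rw [Nat.card_Icc]; omega)
      (by rw [Nat.card_Icc, Nat.add_sub_cancel]; exact sq_le_card_progressions (by omega) hn)
      ℓ hℓ0 (mean k n p) (by rw [mean_eq, hpℓ]) ε hε
    rw [upperTail_eq, Phi, ← hℓ, hpℓ]
    exact this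

end Progressions

/-! ### Generic families and a Poisson-type lower bound -/

section GenericFamilies

open Finset
open scoped Finset

variable {α : Type*} [DecidableEq α]

/-- The families of `j` edges of `H` whose union contains no further edge of `H`. -/
def genericFamilies (H : Finset (Finset α)) (j : ℕ) : Finset (Finset (Finset α)) :=
  (H.powersetCard j).filter (fun 𝒜 => H.filter (· ⊆ 𝒜.biUnion id) = 𝒜)

theorem mem_genericFamilies {H : Finset (Finset α)} {j : ℕ} {𝒜 : Finset (Finset α)} :
    𝒜 ∈ genericFamilies H j ↔ (𝒜 ⊆ H ∧ #𝒜 = j) ∧ H.filter (· ⊆ 𝒜.biUnion id) = 𝒜 := by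
  rw [genericFamilies, mem_filter, mem_powersetCard]

theorem card_biUnion_le_of_mem_genericFamilies {H : Finset (Finset α)} {k j : ℕ}
    (hk : ∀ e ∈ H, #e = k) {𝒜 : Finset (Finset α)} (h : 𝒜 ∈ genericFamilies H j) :
    #(𝒜.biUnion id) ≤ k * j := by
  obtain ⟨⟨h1, rfl⟩, -⟩ := mem_genericFamilies.1 h
  rw [mul_comm]
  exact Finset.card_biUnion_le_card_mul _ _ _ fun e he => (hk e (h1 he)).le

/-- The number of edges that cannot be added to a generic family with vertex set `U`. -/
theorem card_bad_le {H : Finset (Finset α)} {k D d : ℕ} (hk : ∀ e ∈ H, #e = k) (hk3 : 3 ≤ k)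
    (hD : ∀ x y, x ≠ y → #(H.filter (fun e => x ∈ e ∧ y ∈ e)) ≤ D) (hD0 : 0 < D)
    (hd : ∀ x, #(H.filter (x ∈ ·)) ≤ d) (U : Finset α) :
    #(H.filter (fun A => ¬ (Disjoint U A ∧ ∀ B ∈ H, B ⊆ U ∪ A → ¬ B ⊆ U → B = A))) ≤
      3 * k ^ 2 * D * d * #U ^ 2 := by
  let Hp : α × α → Finset (Finset α) := fun z => H.filter (fun e => z.1 ∈ e ∧ z.2 ∈ e)
  let Hv : α → Finset (Finset α) := fun x => H.filter (x ∈ ·)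
  have hcover : H.filter (fun A => ¬ (Disjoint U A ∧ ∀ B ∈ H, B ⊆ U ∪ A → ¬ B ⊆ U → B = A)) ⊆
      (U.biUnion Hv ∪ U.offDiag.biUnion (fun z => (Hp z).biUnion (fun B => B.biUnion Hv))) ∪
        U.biUnion (fun x => (Hv x).biUnion (fun B => B.offDiag.biUnion Hp)) := by
    intro A hA
    obtain ⟨hAH, hA⟩ := mem_filter.1 hA
    rw [mem_union, mem_union]
    by_cases hUA : Disjoint U A
    · have : ∃ B ∈ H, B ⊆ U ∪ A ∧ ¬ B ⊆ U ∧ B ≠ A := by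
        by_contra! h
        exact hA ⟨hUA, h⟩
      obtain ⟨B, hBH, hBUA, hBU, hBA⟩ := this
      obtain ⟨v, hvB, hvU⟩ := Finset.not_subset.1 hBU
      have hvA : v ∈ A := (mem_union.1 (hBUA hvB)).resolve_left hvU
      have hBA' : ¬ B ⊆ A := fun h => hBA (Finset.eq_of_subset_of_card_le h
        (by rw [hk A hAH, hk B hBH]))
      obtain ⟨x, hxB, hxA⟩ := Finset.not_subset.1 hBA'
      have hxU : x ∈ U := (mem_union.1 (hBUA hxB)).resolve_right hxA
      -- An unwanted edge `B` has `x` in `U` and `v` in `A`; since `k ≥ 3` it has a third vertex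
      -- `y`. If `y ∈ U`, the pair `x, y` restricts `B` and then `A` passes through `v`; if `y ∈ A`,
      -- the edge `B` passes through `x` and the pair `v, y` restricts `A`.
      have hthird : ∃ y ∈ B, y ≠ x ∧ y ≠ v := by
        have : 0 < #((B.erase x).erase v) := by
          have h1 := Finset.pred_card_le_card_erase (s := B) (a := x)
          have h2 := Finset.pred_card_le_card_erase (s := B.erase x) (a := v)
          have h3 := hk B hBH
          omega
        obtain ⟨y, hy⟩ := Finset.card_pos.1 this
        rw [mem_erase, mem_erase] at hy
        exact ⟨y, hy.2.2, hy.2.1, hy.1⟩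
      obtain ⟨y, hyB, hyx, hyv⟩ := hthird
      rcases mem_union.1 (hBUA hyB) with hyU | hyA
      · refine Or.inl (Or.inr (mem_biUnion.2 ⟨(x, y), mem_offDiag.2 ⟨hxU, hyU, hyx.symm⟩,
          mem_biUnion.2 ⟨B, mem_filter.2 ⟨hBH, hxB, hyB⟩, mem_biUnion.2 ⟨v, hvB, ?_⟩⟩⟩))
        exact mem_filter.2 ⟨hAH, hvA⟩
      · refine Or.inr (mem_biUnion.2 ⟨x, hxU, mem_biUnion.2 ⟨B, mem_filter.2 ⟨hBH, hxB⟩,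
          mem_biUnion.2 ⟨(v, y), mem_offDiag.2 ⟨hvB, hyB, hyv.symm⟩, ?_⟩⟩⟩)
        exact mem_filter.2 ⟨hAH, hvA, hyA⟩
    · obtain ⟨x, hxU, hxA⟩ := Finset.not_disjoint_iff.1 hUA
      exact Or.inl (Or.inl (mem_biUnion.2 ⟨x, hxU, mem_filter.2 ⟨hAH, hxA⟩⟩))
  have hoff : ∀ B : Finset α, #B.offDiag ≤ #B * #B := fun B => by
    rw [Finset.offDiag_card]; omega
  have c1 : #(U.biUnion Hv) ≤ #U * d := Finset.card_biUnion_le_card_mul _ _ _ fun x _ => hd x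
  have c2 : #(U.offDiag.biUnion (fun z => (Hp z).biUnion (fun B => B.biUnion Hv))) ≤
      #U * #U * (D * (k * d)) := by
    refine (Finset.card_biUnion_le_card_mul _ _ (D * (k * d)) fun z hz => ?_).trans
      (Nat.mul_le_mul_right _ (hoff U))
    refine (Finset.card_biUnion_le_card_mul _ _ (k * d) fun B hB => ?_).trans
      (Nat.mul_le_mul_right _ (hD _ _ (mem_offDiag.1 hz).2.2))
    rw [← hk B (mem_filter.1 hB).1]
    exact Finset.card_biUnion_le_card_mul _ _ _ fun x _ => hd x
  have c3 : #(U.biUnion (fun x => (Hv x).biUnion (fun B => B.offDiag.biUnion Hp))) ≤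
      #U * (d * (k * k * D)) := by
    refine Finset.card_biUnion_le_card_mul _ _ _ fun x _ => ?_
    refine (Finset.card_biUnion_le_card_mul _ _ (k * k * D) fun B hB => ?_).trans
      (Nat.mul_le_mul_right _ (hd x))
    refine (Finset.card_biUnion_le_card_mul _ _ D
      fun z hz => hD _ _ (mem_offDiag.1 hz).2.2).trans (Nat.mul_le_mul_right _ ?_)
    simpa only [hk B (mem_filter.1 hB).1] using hoff B
  refine (Finset.card_le_card hcover).trans ((Finset.card_union_le _ _).trans
    ((Nat.add_le_add_right (Finset.card_union_le _ _) _).trans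
    ((Nat.add_le_add (Nat.add_le_add c1 c2) c3).trans ?_)))
  have hU : #U ≤ #U ^ 2 := Nat.le_self_pow two_ne_zero _
  have hk1 : 1 ≤ k ^ 2 * D := Nat.mul_pos (by positivity) hD0
  have hkk : k ≤ k ^ 2 := Nat.le_self_pow two_ne_zero _
  have a1 : #U * d ≤ #U ^ 2 * d * (k ^ 2 * D) :=
    calc #U * d = #U * d * 1 := (mul_one _).symm
      _ ≤ _ := Nat.mul_le_mul (Nat.mul_le_mul_right _ hU) hk1
  have a2 : #U * #U * (D * (k * d)) ≤ #U * #U * (D * (k ^ 2 * d)) := by gcongr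
  calc #U * d + #U * #U * (D * (k * d)) + #U * (d * (k * k * D))
      ≤ #U ^ 2 * d * (k ^ 2 * D) + #U * #U * (D * (k ^ 2 * d)) + #U ^ 2 * (d * (k * k * D)) :=
        Nat.add_le_add (Nat.add_le_add a1 a2) (Nat.mul_le_mul_right _ hU)
    _ = _ := by ring

/-- Double counting of inclusions: as long as `m` is small, at most half of the edges are bad, so a
generic family of size `j` has at least `#H / 2` generic extensions, while one of size `j + 1`
arises from at most `j + 1` families. -/
theorem pow_le_factorial_mul_card_genericFamilies {H : Finset (Finset α)} {k D d : ℕ}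
    (hk : ∀ e ∈ H, #e = k) (hk3 : 3 ≤ k)
    (hD : ∀ x y, x ≠ y → #(H.filter (fun e => x ∈ e ∧ y ∈ e)) ≤ D) (hD0 : 0 < D)
    (hd : ∀ x, #(H.filter (x ∈ ·)) ≤ d) (m : ℕ) (hm : 6 * k ^ 4 * D * d * m ^ 2 ≤ #H) :
    ((#H : ℝ) / 2) ^ m ≤ m.factorial * #(genericFamilies H m) := by
  induction m with
  | zero =>
    have : ∅ ∈ genericFamilies H 0 := by
      refine mem_genericFamilies.2 ⟨by simp, ?_⟩
      refine Finset.filter_eq_empty_iff.2 fun e he h => ?_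
      have h1 := hk e he
      rw [Finset.biUnion_empty, Finset.subset_empty] at h
      rw [h, Finset.card_empty] at h1
      omega
    have h1 : 1 ≤ #(genericFamilies H 0) := Finset.card_pos.2 ⟨_, this⟩
    simpa using h1
  | succ j ih =>
    have hj : 6 * k ^ 4 * D * d * j ^ 2 ≤ #H := by
      refine le_trans ?_ hm
      gcongr
      omega
    have hext : ∀ 𝒜 ∈ genericFamilies H j, #H - #H / 2 ≤
        #((genericFamilies H (j + 1)).bipartiteAbove (· ⊆ ·) 𝒜) := by
      intro 𝒜 h𝒜
      obtain ⟨⟨h𝒜H, h𝒜j⟩, h𝒜g⟩ := mem_genericFamilies.1 h𝒜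
      set U := 𝒜.biUnion id with hU
      set good := H.filter (fun A => Disjoint U A ∧ ∀ B ∈ H, B ⊆ U ∪ A → ¬ B ⊆ U → B = A)
        with hgood
      have hbad := card_bad_le hk hk3 hD hD0 hd U
      have hUc : #U ≤ k * j := card_biUnion_le_of_mem_genericFamilies hk h𝒜
      have hbad2 : 2 * (3 * k ^ 2 * D * d * #U ^ 2) ≤ #H := by
        refine le_trans ?_ hj
        calc 2 * (3 * k ^ 2 * D * d * #U ^ 2) ≤ 2 * (3 * k ^ 2 * D * d * (k * j) ^ 2) := by gcongr
          _ = _ := by ring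
      have hsplit := Finset.card_filter_add_card_filter_not (s := H)
        (fun A => Disjoint U A ∧ ∀ B ∈ H, B ⊆ U ∪ A → ¬ B ⊆ U → B = A)
      rw [← hgood] at hsplit
      have hgoodc : #H - #H / 2 ≤ #good := by omega
      have hnot : ∀ A ∈ good, A ∉ 𝒜 := by
        intro A hA hA𝒜
        obtain ⟨hAH, hdis, -⟩ := mem_filter.1 hA
        have hAU : A ⊆ U := Finset.subset_biUnion_of_mem id hA𝒜
        have h1 := hk A hAH
        rw [Finset.disjoint_of_subset_left hAU hdis |>.eq_bot_of_self] at h1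
        simp at h1
        omega
      have hinj : Set.InjOn (fun A => insert A 𝒜) (good : Set (Finset α)) := by
        intro A hA A' hA' h
        have : A ∈ insert A' 𝒜 := by
          have h' : insert A 𝒜 = insert A' 𝒜 := h
          rw [← h']; exact mem_insert_self _ _
        exact (mem_insert.1 this).resolve_right (hnot A hA)
      refine hgoodc.trans ((Finset.card_image_of_injOn hinj).ge.trans (Finset.card_le_card ?_))
      intro ℬ hℬ
      obtain ⟨A, hA, rfl⟩ := mem_image.1 hℬ
      obtain ⟨hAH, hdis, huniq⟩ := mem_filter.1 hA
      refine (Finset.mem_bipartiteAbove _).2 ⟨mem_genericFamilies.2 ⟨⟨Finset.insert_subset hAH h𝒜H, ?_⟩,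
        ?_⟩, Finset.subset_insert _ _⟩
      · rw [Finset.card_insert_of_notMem (hnot A hA), h𝒜j]
      · rw [Finset.biUnion_insert, ← hU, id, Finset.union_comm]
        ext B
        rw [mem_filter, mem_insert]
        constructor
        · rintro ⟨hBH, hB⟩
          by_cases hBU : B ⊆ U
          · right
            rw [← h𝒜g]
            exact mem_filter.2 ⟨hBH, hBU⟩
          · exact Or.inl (huniq B hBH hB hBU)
        · rintro (rfl | hB)
          · exact ⟨hAH, Finset.subset_union_right⟩
          · exact ⟨h𝒜H hB, (Finset.subset_biUnion_of_mem id hB).trans Finset.subset_union_left⟩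
    have hbelow : ∀ ℬ ∈ genericFamilies H (j + 1),
        #((genericFamilies H j).bipartiteBelow (· ⊆ ·) ℬ) ≤ j + 1 := by
      intro ℬ hℬ
      have h1 : #(ℬ.powersetCard j) = j + 1 := by
        rw [Finset.card_powersetCard, (mem_genericFamilies.1 hℬ).1.2, Nat.choose_succ_self_right]
      rw [← h1]
      refine Finset.card_le_card fun 𝒜 h𝒜 => ?_
      obtain ⟨h2, h3⟩ := (Finset.mem_bipartiteBelow _).1 h𝒜
      exact mem_powersetCard.2 ⟨h3, (mem_genericFamilies.1 h2).1.2⟩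
    have hdouble := Finset.card_mul_le_card_mul (fun 𝒜 ℬ : Finset (Finset α) => 𝒜 ⊆ ℬ) hext hbelow
    have hhalf : (#H : ℝ) / 2 ≤ (#H - #H / 2 : ℕ) := by
      have : #H ≤ 2 * (#H - #H / 2) := by omega
      have : (#H : ℝ) ≤ 2 * (#H - #H / 2 : ℕ) := by exact_mod_cast this
      linarith
    have hdouble' : (#(genericFamilies H j) : ℝ) * (#H - #H / 2 : ℕ) ≤
        #(genericFamilies H (j + 1)) * (j + 1 : ℕ) := by exact_mod_cast hdouble
    calc ((#H : ℝ) / 2) ^ (j + 1) = (#H / 2) ^ j * (#H / 2) := pow_succ _ _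
      _ ≤ j.factorial * #(genericFamilies H j) * (#H - #H / 2 : ℕ) := by
          gcongr
          exact ih hj
      _ = j.factorial * (#(genericFamilies H j) * (#H - #H / 2 : ℕ)) := mul_assoc _ _ _
      _ ≤ j.factorial * (#(genericFamilies H (j + 1)) * (j + 1 : ℕ)) := by gcongr
      _ = _ := by rw [Nat.factorial_succ]; push_cast; ring

theorem exp_neg_two_mul_le {x : ℝ} (h0 : 0 ≤ x) (h1 : x ≤ 1 / 2) : Real.exp (-(2 * x)) ≤ 1 - x := by
  rw [Real.exp_neg, inv_le_comm₀ (Real.exp_pos _) (by linarith)]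
  refine le_trans ?_ (Real.add_one_le_exp _)
  rw [inv_le_iff_one_le_mul₀ (by linarith)]
  nlinarith

/-- Total weight of the edges outside `U`, when the vertices of `U` have been exposed. -/
theorem sum_pow_card_sdiff_le {H : Finset (Finset α)} {k D d : ℕ} (hk : ∀ e ∈ H, #e = k)
    (hk3 : 3 ≤ k) (hD : ∀ x y, x ≠ y → #(H.filter (fun e => x ∈ e ∧ y ∈ e)) ≤ D)
    (hd : ∀ x, #(H.filter (x ∈ ·)) ≤ d) {p : ℝ} (h0 : 0 ≤ p) (h1 : p ≤ 1) (U : Finset α) :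
    ∑ B ∈ H.filter (fun B => ¬ B ⊆ U), p ^ #(B \ U) ≤
      #H * p ^ k + #U * d * p ^ (k - 1) + #U ^ 2 * D * p := by
  let Hp : α × α → Finset (Finset α) := fun z => H.filter (fun e => z.1 ∈ e ∧ z.2 ∈ e)
  let Hv : α → Finset (Finset α) := fun x => H.filter (x ∈ ·)
  -- The three terms treat `#(B ∩ U)` equal to `0`, to `1`, and at least `2`. In the last case only
  -- `B \ U ≠ ∅` is used, and the codegree bounds the number of such `B`.
  have hpt : ∀ B ∈ H.filter (fun B => ¬ B ⊆ U), p ^ #(B \ U) ≤ p ^ k +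
      (if B ∈ U.biUnion Hv then p ^ (k - 1) else 0) +
      (if B ∈ U.offDiag.biUnion Hp then p else 0) := by
    intro B hB
    obtain ⟨hBH, hBU⟩ := mem_filter.1 hB
    have hsum : #(B \ U) + #(B ∩ U) = k := by
      rw [Finset.card_sdiff_add_card_inter, hk B hBH]
    have hne : #(B \ U) ≠ 0 := by
      rw [Ne, Finset.card_eq_zero, Finset.sdiff_eq_empty_iff_subset]; exact hBU
    have n1 : 0 ≤ if B ∈ U.biUnion Hv then p ^ (k - 1) else 0 := by split_ifs <;> positivity
    have n2 : 0 ≤ if B ∈ U.offDiag.biUnion Hp then p else 0 := by split_ifs <;> positivity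
    rcases Nat.lt_or_ge 1 #(B ∩ U) with h | h
    · obtain ⟨x, hx, y, hy, hxy⟩ := Finset.one_lt_card.1 h
      rw [mem_inter] at hx hy
      have hmem : B ∈ U.offDiag.biUnion Hp := mem_biUnion.2 ⟨(x, y),
        mem_offDiag.2 ⟨hx.2, hy.2, hxy⟩, mem_filter.2 ⟨hBH, hx.1, hy.1⟩⟩
      rw [if_pos hmem]
      have := pow_le_of_le_one h0 h1 hne
      have : 0 ≤ p ^ k := by positivity
      linarith
    · rcases Nat.eq_zero_or_pos #(B ∩ U) with h' | h'
      · rw [show #(B \ U) = k by omega]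
        linarith
      · obtain ⟨x, hx⟩ := Finset.card_pos.1 h'
        rw [mem_inter] at hx
        have hmem : B ∈ U.biUnion Hv := mem_biUnion.2 ⟨x, hx.2, mem_filter.2 ⟨hBH, hx.1⟩⟩
        rw [if_pos hmem, show #(B \ U) = k - 1 by omega]
        have : 0 ≤ p ^ k := by positivity
        linarith
  refine (Finset.sum_le_sum hpt).trans ?_
  refine (Finset.sum_le_sum_of_subset_of_nonneg (Finset.filter_subset _ H)
    fun B _ _ => by positivity).trans ?_
  rw [Finset.sum_add_distrib, Finset.sum_add_distrib, Finset.sum_const, nsmul_eq_mul,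
    ← Finset.sum_filter, ← Finset.sum_filter, Finset.sum_const, nsmul_eq_mul, Finset.sum_const,
    nsmul_eq_mul]
  have c1 : #(H.filter (· ∈ U.biUnion Hv)) ≤ #U * d :=
    (Finset.card_le_card fun B hB => (mem_filter.1 hB).2).trans
      (Finset.card_biUnion_le_card_mul _ _ _ fun x _ => hd x)
  have c2 : #(H.filter (· ∈ U.offDiag.biUnion Hp)) ≤ #U ^ 2 * D := by
    refine (Finset.card_le_card fun B hB => (mem_filter.1 hB).2).trans
      ((Finset.card_biUnion_le_card_mul _ _ D fun z hz => hD _ _ (mem_offDiag.1 hz).2.2).trans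
      (Nat.mul_le_mul_right _ ?_))
    rw [Finset.offDiag_card, sq]
    omega
  have c1' : (#(H.filter (· ∈ U.biUnion Hv)) : ℝ) ≤ #U * d := by exact_mod_cast c1
  have c2' : (#(H.filter (· ∈ U.offDiag.biUnion Hp)) : ℝ) ≤ #U ^ 2 * D := by exact_mod_cast c2
  gcongr

/-- A Poisson-type lower bound for the probability of containing at least `m` edges. -/
theorem pow_mul_exp_le_binExp {V : Finset α} {p : ℝ} (h0 : 0 ≤ p) (h1 : p ≤ 1 / 2)
    {H : Finset (Finset α)} (hV : ∀ e ∈ H, e ⊆ V) {k D d : ℕ} (hk : ∀ e ∈ H, #e = k)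
    (hk3 : 3 ≤ k) (hD : ∀ x y, x ≠ y → #(H.filter (fun e => x ∈ e ∧ y ∈ e)) ≤ D) (hD0 : 0 < D)
    (hd : ∀ x, #(H.filter (x ∈ ·)) ≤ d) {m : ℕ} (hm : 6 * k ^ 4 * D * d * m ^ 2 ≤ #H) :
    (#H * p ^ k / 2) ^ m / m.factorial * Real.exp (-(2 * (#H * p ^ k +
      (k * m : ℕ) * d * p ^ (k - 1) + (k * m : ℕ) ^ 2 * D * p))) ≤
      binExp V p (fun S => if m ≤ #(H.filter (· ⊆ S)) then 1 else 0) := by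
  have hp1 : p ≤ 1 := by linarith
  set E := Real.exp (-(2 * (#H * p ^ k + (k * m : ℕ) * d * p ^ (k - 1) +
    (k * m : ℕ) ^ 2 * D * p))) with hE
  have hmain : binExp V p (fun S => ∑ 𝒜 ∈ genericFamilies H m,
      if 𝒜.biUnion id ⊆ S ∧ ∀ B ∈ H.filter (fun B => ¬ B ⊆ 𝒜.biUnion id), ¬ id B ⊆ S
        then 1 else 0) ≤ binExp V p (fun S => if m ≤ #(H.filter (· ⊆ S)) then 1 else 0) := by
    refine binExp_mono h0 hp1 fun S _ => ?_
    -- Genericity lets `𝒜` be recovered from `S`, so these events are disjoint and their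
    -- probabilities may be added.
    have hkey : ∀ 𝒜 ∈ genericFamilies H m, (𝒜.biUnion id ⊆ S ∧
        ∀ B ∈ H.filter (fun B => ¬ B ⊆ 𝒜.biUnion id), ¬ id B ⊆ S) → 𝒜 = H.filter (· ⊆ S) := by
      intro 𝒜 h𝒜 ⟨hUS, hno⟩
      obtain ⟨⟨h𝒜H, -⟩, h𝒜g⟩ := mem_genericFamilies.1 h𝒜
      ext B
      rw [mem_filter]
      refine ⟨fun hB => ⟨h𝒜H hB, (Finset.subset_biUnion_of_mem id hB).trans hUS⟩, fun hB => ?_⟩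
      rw [← h𝒜g]
      refine mem_filter.2 ⟨hB.1, ?_⟩
      by_contra hBU
      exact hno B (mem_filter.2 ⟨hB.1, hBU⟩) hB.2
    have hle : ∀ 𝒜 ∈ genericFamilies H m, (if 𝒜.biUnion id ⊆ S ∧
        ∀ B ∈ H.filter (fun B => ¬ B ⊆ 𝒜.biUnion id), ¬ id B ⊆ S then (1 : ℝ) else 0) ≤
        if H.filter (· ⊆ S) = 𝒜 then 1 else 0 := by
      intro 𝒜 h𝒜
      split_ifs with a b
      · exact le_rfl
      · exact absurd (hkey 𝒜 h𝒜 a).symm b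
      · exact zero_le_one
      · exact le_rfl
    refine (Finset.sum_le_sum hle).trans ?_
    rw [Finset.sum_ite_eq]
    split_ifs with a b
    · exact le_rfl
    · exact absurd (mem_genericFamilies.1 a).1.2.ge b
    · exact zero_le_one
    · exact le_rfl
  refine le_trans ?_ hmain
  rw [binExp_sum]
  have hterm : ∀ 𝒜 ∈ genericFamilies H m, (p ^ k) ^ m * E ≤ binExp V p (fun S =>
      if 𝒜.biUnion id ⊆ S ∧ ∀ B ∈ H.filter (fun B => ¬ B ⊆ 𝒜.biUnion id), ¬ id B ⊆ S
        then 1 else 0) := by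
    intro 𝒜 h𝒜
    obtain ⟨⟨h𝒜H, -⟩, -⟩ := mem_genericFamilies.1 h𝒜
    have hUc := card_biUnion_le_of_mem_genericFamilies hk h𝒜
    set U := 𝒜.biUnion id with hU
    refine le_trans ?_ (pow_mul_prod_le_binExp V h0 hp1 (H.filter (fun B => ¬ B ⊆ U)) id U
      (Finset.biUnion_subset.2 fun e he => hV e (h𝒜H he)) fun B hB => hV B (mem_filter.1 hB).1)
    refine mul_le_mul ?_ ?_ (Real.exp_pos _).le (by positivity)
    · rw [← pow_mul]
      exact pow_le_pow_of_le_one h0 hp1 hUc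
    · have hsum := sum_pow_card_sdiff_le hk hk3 hD hd h0 hp1 U
      have hUc' : (#U : ℝ) ≤ (k * m : ℕ) := by exact_mod_cast hUc
      calc E ≤ Real.exp (-(2 * ∑ B ∈ H.filter (fun B => ¬ B ⊆ U), p ^ #(B \ U))) := by
            refine Real.exp_le_exp.2 (neg_le_neg ?_)
            gcongr
            refine hsum.trans ?_
            gcongr
        _ = ∏ B ∈ H.filter (fun B => ¬ B ⊆ U), Real.exp (-(2 * p ^ #(B \ U))) := by
            rw [← Real.exp_sum, Finset.sum_neg_distrib, Finset.mul_sum]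
        _ ≤ _ := by
            refine Finset.prod_le_prod (fun B _ => (Real.exp_pos _).le) fun B hB => ?_
            refine exp_neg_two_mul_le (by positivity) ((pow_le_of_le_one h0 hp1 ?_).trans h1)
            rw [Ne, Finset.card_eq_zero, Finset.sdiff_eq_empty_iff_subset]
            exact (mem_filter.1 hB).2
  refine le_trans ?_ (Finset.sum_le_sum hterm)
  rw [Finset.sum_const, nsmul_eq_mul]
  have hcount := pow_le_factorial_mul_card_genericFamilies hk hk3 hD hD0 hd m hm
  have hfac : (0 : ℝ) < m.factorial := by exact_mod_cast m.factorial_pos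
  calc (#H * p ^ k / 2) ^ m / m.factorial * E
      = (#H / 2) ^ m / m.factorial * ((p ^ k) ^ m * E) := by
        rw [mul_div_right_comm, mul_pow]; ring
    _ ≤ #(genericFamilies H m) * ((p ^ k) ^ m * E) := by
        gcongr
        rwa [div_le_iff₀' hfac]

end GenericFamilies

/-! ### The two strategies for the lower bound -/

section LowerTail

open Finset
open scoped Finset

/-- The lower bound obtained by placing an interval into the random set. -/
theorem exp_neg_sqrt_le_upperTail {k n : ℕ} (hk : 2 ≤ k) {p : unitInterval} (hp : 0 < (p : ℝ))
    {ε : ℝ} (h1 : 1 ≤ (1 + ε) * mean k n p)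
    (hN : (1 + ε) * mean k n p ≤ #(progressions k n)) :
    Real.exp (-((6 * k + 1) * √((1 + ε) * mean k n p) * Real.log (1 / (p : ℝ)))) ≤
      upperTail k n p ε := by
  classical
  set x := (1 + ε) * mean k n p with hx
  have hk0 : (2 : ℝ) ≤ k := by exact_mod_cast hk
  -- The shortest suitable interval is planted: as length `L - 1` fails, the quadratic count gives
  -- `L = O(√x)`. Lengths up to `2 * k` are covered by `1 ≤ √x`.
  have hex : ∃ L, x ≤ #((progressions k n).filter (· ⊆ Finset.Icc 1 L)) := by
    refine ⟨n, hN.trans_eq ?_⟩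
    rw [Finset.filter_true_of_mem fun e he => subset_of_mem_progressions he]
  have hLn : Nat.find hex ≤ n := Nat.find_min' hex (by
    rwa [Finset.filter_true_of_mem fun e he => subset_of_mem_progressions he])
  have hLx : x ≤ #((progressions k n).filter (· ⊆ Finset.Icc 1 (Nat.find hex))) :=
    Nat.find_spec hex
  obtain ⟨L, hL⟩ : ∃ L, L = Nat.find hex := ⟨_, rfl⟩
  have hsx : 1 ≤ √x := Real.one_le_sqrt.2 h1
  have hLup : (L : ℝ) ≤ (6 * k + 1) * √x := by
    rcases Nat.lt_or_ge (2 * k) L with h | h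
    · have hmin := Nat.find_min hex (m := L - 1) (by omega)
      rw [not_le] at hmin
      have h2 := sq_le_card_filter_subset_Icc (k := k) (n := n) (L := L - 1) hk (by omega) (by omega)
      have h3 : ((L - 1 : ℕ) : ℝ) ^ 2 ≤ 16 * k * x := by
        have h4 := h2.trans hmin.le
        rw [one_div_mul_eq_div, div_le_iff₀ (by positivity)] at h4
        linarith
      have h5 : ((L - 1 : ℕ) : ℝ) ≤ 4 * k * √x := by
        refine (Real.le_sqrt_of_sq_le (h3.trans ?_)).trans_eq (Real.sqrt_sq (by positivity))
        rw [mul_pow, Real.sq_sqrt (by linarith)]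
        have : (k : ℝ) ≤ k ^ 2 := by nlinarith
        nlinarith
      rw [Nat.cast_sub (by omega), Nat.cast_one] at h5
      nlinarith
    · have : (L : ℝ) ≤ 2 * k := by exact_mod_cast h
      nlinarith
  have hprob : (p : ℝ) ^ L ≤ upperTail k n p ε := by
    rw [upperTail_eq]
    have hb := binExp_subset (V := Finset.Icc 1 n) (A := Finset.Icc 1 L) (p : ℝ)
      (Finset.Icc_subset_Icc_right (hL ▸ hLn))
    rw [Nat.card_Icc, Nat.add_sub_cancel] at hb
    rw [← hb]
    refine binExp_mono p.2.1 p.2.2 fun S _ => ?_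
    split_ifs with a b
    · exact le_rfl
    · refine absurd (hLx.trans ?_) b
      rw [← hL]
      refine Nat.cast_le.2 (Finset.card_le_card fun e he => ?_)
      exact mem_filter.2 ⟨(mem_filter.1 he).1, (mem_filter.1 he).2.trans a⟩
    · exact zero_le_one
    · exact le_rfl
  refine le_trans ?_ hprob
  have hℓ : 0 ≤ Real.log (1 / (p : ℝ)) := Real.log_nonneg (one_le_one_div hp p.2.2)
  have hpℓ : (p : ℝ) = Real.exp (-Real.log (1 / (p : ℝ))) := by
    rw [one_div, Real.log_inv, neg_neg, Real.exp_log hp]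
  calc _ ≤ Real.exp (L * -Real.log (1 / (p : ℝ))) := by
        refine Real.exp_le_exp.2 ?_
        rw [mul_neg]
        exact neg_le_neg (mul_le_mul_of_nonneg_right hLup hℓ)
    _ = (p : ℝ) ^ L := by rw [Real.exp_nat_mul, ← hpℓ]

theorem exists_forall_log_pow_le (C : ℝ) (j : ℕ) :
    ∃ n₀ : ℕ, ∀ n : ℕ, n₀ ≤ n → C * Real.log n ^ j ≤ n := by
  have h := (Real.isLittleO_pow_log_id_atTop (n := j)).comp_tendsto tendsto_natCast_atTop_atTop
  have h2 := h.def (c := 1 / (|C| + 1)) (by positivity)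
  obtain ⟨n₀, hn₀⟩ := Filter.eventually_atTop.1 h2
  refine ⟨n₀, fun n hn => ?_⟩
  have h3 := hn₀ n hn
  simp only [Function.comp_apply, id, Real.norm_eq_abs, Nat.abs_cast] at h3
  rw [one_div_mul_eq_div, le_div_iff₀ (by positivity)] at h3
  have h5 := le_abs_self C
  calc C * Real.log n ^ j ≤ |C| * |Real.log n ^ j| := by rw [← abs_mul]; exact le_abs_self _
    _ ≤ |Real.log n ^ j| * (|C| + 1) := by nlinarith [abs_nonneg (Real.log n ^ j)]
    _ ≤ n := h3

/-- The lower bound coming from the Poisson-type estimate, in terms of the number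
`m ≤ 2 (1 + ε) μ` of progressions. -/
theorem exp_neg_le_poisson {m : ℕ} {μ ε M E : ℝ} (hμ : 0 < μ) (hε : 0 < ε)
    (hM : 1 + ε ≤ 2 * M) (hM2 : (1 + ε) ^ 2 ≤ 4 * M) (hM1 : 1 ≤ M) (hE : 0 ≤ E)
    (h1 : 1 ≤ (1 + ε) * μ) (hm : (m : ℝ) ≤ 2 * ((1 + ε) * μ)) (hm0 : 0 < m) :
    Real.exp (-((34 + 4 * E) * M * μ)) ≤
      (μ / 2) ^ m / m.factorial * Real.exp (-(2 * (μ + E))) := by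
  have hm' : (0 : ℝ) < m := by exact_mod_cast hm0
  have hε1 : 0 < 1 + ε := by linarith
  have hfac : (μ / (2 * m)) ^ m ≤ (μ / 2) ^ m / m.factorial := by
    rw [← div_div, div_pow (μ / 2)]
    gcongr
    exact_mod_cast Nat.factorial_le_pow m
  have hbase : Real.exp (-(4 * (1 + ε))) ≤ μ / (2 * m) := by
    have h2 : 1 / (4 * (1 + ε)) ≤ μ / (2 * m) := by
      rw [div_le_div_iff₀ (by positivity) (by positivity)]
      linarith
    refine le_trans ?_ h2
    rw [Real.exp_neg, one_div]
    have := Real.add_one_le_exp (4 * (1 + ε))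
    gcongr
    linarith
  have hpow : Real.exp (-(32 * M * μ)) ≤ (μ / (2 * m)) ^ m := by
    refine le_trans ?_ (pow_le_pow_left₀ (Real.exp_pos _).le hbase m)
    rw [← Real.exp_nat_mul]
    refine Real.exp_le_exp.2 ?_
    have : (m : ℝ) * (4 * (1 + ε)) ≤ 2 * ((1 + ε) * μ) * (4 * (1 + ε)) := by gcongr
    nlinarith
  calc Real.exp (-((34 + 4 * E) * M * μ))
      ≤ Real.exp (-(32 * M * μ)) * Real.exp (-(2 * (μ + E))) := by
        rw [← Real.exp_add]
        refine Real.exp_le_exp.2 ?_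
        have a1 : μ ≤ M * μ := le_mul_of_one_le_left hμ.le hM1
        -- The bounded error `E` is absorbed into the exponent because `1 ≤ (1 + ε) * μ ≤ 2 * M *
        -- μ`.
        have a2 : 1 ≤ 2 * (M * μ) := by nlinarith
        have a3 : E ≤ E * (2 * (M * μ)) := le_mul_of_one_le_right hE a2
        nlinarith
    _ ≤ _ := by
        gcongr
        exact hpow.trans hfac

/-- In the range where planting an interval is too expensive, the mean is at most
polylogarithmic and not too small. -/
theorem poisson_range {μ ε ℓ M : ℝ} (hμ : 0 < μ) (hε : 0 < ε) (hℓ : 0 < ℓ) (hM0 : 0 < M)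
    (hM : 1 + ε ≤ 2 * M) (hM2 : (1 + ε) ^ 2 ≤ 4 * M) (h1 : 1 ≤ (1 + ε) * μ)
    (h : M * μ < √((1 + ε) * μ) * ℓ) : (1 + ε) * μ ≤ 4 * ℓ ^ 2 ∧ 1 ≤ 4 * ℓ * μ := by
  have hε1 : 0 < 1 + ε := by linarith
  have hsq : (M * μ) ^ 2 < (1 + ε) * μ * ℓ ^ 2 := by
    have := pow_lt_pow_left₀ h (by positivity) two_ne_zero
    rwa [mul_pow (√_), Real.sq_sqrt (by positivity)] at this
  have hsq' : M ^ 2 * μ < (1 + ε) * ℓ ^ 2 := by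
    refine lt_of_mul_lt_mul_right ?_ hμ.le
    nlinarith
  constructor
  · have a1 : (1 + ε) ^ 2 ≤ 4 * M ^ 2 := by nlinarith
    have a2 : (1 + ε) ^ 2 * μ ≤ 4 * M ^ 2 * μ := by gcongr
    refine le_of_mul_le_mul_left ?_ hε1
    nlinarith
  -- Here `M` must be of order `(1 + ε) ^ 2`: then `(1 + ε) ^ 3 * μ ≤ 16 * ℓ ^ 2`, and multiplying
  -- by `μ ^ 2` removes `ε` through `1 ≤ ((1 + ε) * μ) ^ 3`.
  · have a1 : ((1 + ε) ^ 2) ^ 2 ≤ (4 * M) ^ 2 := by gcongr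
    have a2 : (1 + ε) ^ 4 * μ ≤ 16 * M ^ 2 * μ := by
      calc (1 + ε) ^ 4 * μ = ((1 + ε) ^ 2) ^ 2 * μ := by ring
        _ ≤ (4 * M) ^ 2 * μ := by gcongr
        _ = _ := by ring
    have a3 : (1 + ε) ^ 3 * μ ≤ 16 * ℓ ^ 2 := by
      refine le_of_mul_le_mul_left ?_ hε1
      nlinarith
    have a4 : 1 ≤ ((1 + ε) * μ) ^ 3 := one_le_pow₀ h1
    have a5 : 1 ≤ (4 * ℓ * μ) ^ 2 := by
      calc 1 ≤ ((1 + ε) * μ) ^ 3 := a4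
        _ = (1 + ε) ^ 3 * μ * μ ^ 2 := by ring
        _ ≤ 16 * ℓ ^ 2 * μ ^ 2 := by gcongr
        _ = _ := by ring
    exact (one_le_sq_iff₀ (by positivity)).1 a5

/-- If `ℓ > log n`, then `μ ≤ n ^ 2 * exp (-(3 * ℓ)) ≤ exp (-ℓ)`, and `4 * ℓ * exp (-ℓ) < 1` for `ℓ
> 3`. -/
theorem log_inv_le_log {n : ℕ} {N ℓ μ : ℝ} {k : ℕ} (hk : 3 ≤ k) (hn : 0 < n)
    (hN : N ≤ (n : ℝ) ^ 2) (hℓ : 0 < ℓ) (hμ : μ = N * Real.exp (-ℓ) ^ k) (h : 1 ≤ 4 * ℓ * μ)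
    (hu : 3 ≤ Real.log n) : ℓ ≤ Real.log n := by
  by_contra! hcon
  have hn' : (0 : ℝ) < n := by exact_mod_cast hn
  obtain ⟨u, hu'⟩ : ∃ u, u = Real.log n := ⟨_, rfl⟩
  rw [← hu'] at hcon hu
  have hnu : (n : ℝ) = Real.exp u := by rw [hu', Real.exp_log hn']
  have h1 : μ ≤ Real.exp (-ℓ) := by
    have h2 : Real.exp (-ℓ) ^ k ≤ Real.exp (-ℓ) ^ 3 :=
      pow_le_pow_of_le_one (Real.exp_pos _).le (Real.exp_le_one_iff.2 (by linarith)) hk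
    calc μ ≤ (n : ℝ) ^ 2 * Real.exp (-ℓ) ^ 3 := by rw [hμ]; gcongr
      _ = Real.exp (2 * u - 3 * ℓ) := by
        rw [hnu, ← Real.exp_nat_mul, ← Real.exp_nat_mul, ← Real.exp_add]
        congr 1; push_cast; ring
      _ ≤ Real.exp (-ℓ) := Real.exp_le_exp.2 (by linarith)
  have h3 : 4 * ℓ * Real.exp (-ℓ) < 1 := by
    rw [Real.exp_neg, ← div_eq_mul_inv, div_lt_one (Real.exp_pos _)]
    have h6 : Real.exp ℓ = Real.exp (ℓ / 3) ^ 3 := by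
      rw [← Real.exp_nat_mul]; congr 1; push_cast; ring
    have h7 : (1 + ℓ / 3 + (ℓ / 3) ^ 2 / 2) ^ 3 ≤ Real.exp ℓ := by
      rw [h6]
      gcongr
      exact Real.quadratic_le_exp_of_nonneg (by positivity)
    nlinarith [mul_pos hℓ hℓ, sq_nonneg (ℓ - 3), mul_nonneg hℓ.le (sq_nonneg (ℓ - 3))]
  nlinarith

/-- The lower bound coming from generic families of progressions. -/
theorem exists_exp_neg_le_upperTail (k : ℕ) (hk : 3 ≤ k) : ∃ n₀ : ℕ, ∃ B : ℝ, 0 < B ∧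
    ∀ n : ℕ, n₀ ≤ n → ∀ p : unitInterval, 0 < (p : ℝ) → (p : ℝ) < 1 → ∀ ε : ℝ, 0 < ε →
      1 ≤ (1 + ε) * mean k n p →
      max 1 (ε ^ 2) * mean k n p < √((1 + ε) * mean k n p) * Real.log (1 / (p : ℝ)) →
      Real.exp (-(B * max 1 (ε ^ 2) * mean k n p)) ≤ upperTail k n p ε := by
  have hk0 : (3 : ℝ) ≤ k := by exact_mod_cast hk
  -- The first threshold allows generic families of size `m ≤ 8 * ℓ ^ 2`; the second keeps the
  -- degree term in the Poisson exponent below `1`. Below, `21` exceeds `e ^ 3`, and `64 * k * 2 ^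
  -- k` excludes `p > 1 / 2`.
  obtain ⟨n₁, hn₁⟩ := exists_forall_log_pow_le (6144 * k ^ 9) 4
  obtain ⟨n₂, hn₂⟩ := exists_forall_log_pow_le (4 * (512 * k ^ 4) ^ 3) 13
  refine ⟨max (max n₁ n₂) (max 21 (64 * k * 2 ^ k + 2 * k)), 34 + 4 * (1 + 1536 * (k : ℝ) ^ 4),
    by positivity, ?_⟩
  intro n hn p hp hp1 ε hε h1 hreg
  have hn1 := hn₁ n ((le_max_left _ _).trans ((le_max_left _ _).trans hn))
  have hn2 := hn₂ n ((le_max_right _ _).trans ((le_max_left _ _).trans hn))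
  have hn21 : 21 ≤ n := (le_max_left _ _).trans ((le_max_right _ _).trans hn)
  have hnk : 64 * k * 2 ^ k + 2 * k ≤ n := (le_max_right _ _).trans ((le_max_right _ _).trans hn)
  have hn0 : (1 : ℝ) ≤ n := by exact_mod_cast (by omega : 1 ≤ n)
  obtain ⟨ℓ, hℓ⟩ : ∃ ℓ, ℓ = Real.log (1 / (p : ℝ)) := ⟨_, rfl⟩
  have hℓ0 : 0 < ℓ := by rw [hℓ]; exact Real.log_pos (one_lt_one_div hp hp1)
  have hpℓ : (p : ℝ) = Real.exp (-ℓ) := by rw [hℓ, one_div, Real.log_inv, neg_neg, Real.exp_log hp]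
  have hu3 : 3 ≤ Real.log n := by
    rw [Real.le_log_iff_exp_le (by linarith)]
    have e1 := Real.exp_one_lt_d9
    have e2 : Real.exp 3 = Real.exp 1 ^ 3 := by rw [← Real.exp_nat_mul]; norm_num
    have e3 : Real.exp 1 ^ 3 ≤ 2.7182818286 ^ 3 := by gcongr
    have e4 : (21 : ℝ) ≤ n := by exact_mod_cast hn21
    rw [e2]
    norm_num at e3 ⊢
    linarith
  obtain ⟨M, hM⟩ : ∃ M, M = max 1 (ε ^ 2) := ⟨_, rfl⟩
  have hM1 : 1 ≤ M := by rw [hM]; exact le_max_left _ _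
  have hMε : ε ^ 2 ≤ M := by rw [hM]; exact le_max_right _ _
  have hMa : 1 + ε ≤ 2 * M := by nlinarith [sq_nonneg (ε - 1)]
  have hMb : (1 + ε) ^ 2 ≤ 4 * M := by nlinarith [sq_nonneg (ε - 1)]
  have hNlow := sq_le_card_progressions (k := k) (n := n) (by omega) (by omega)
  have hNup : (#(progressions k n) : ℝ) ≤ (n : ℝ) ^ 2 := by
    exact_mod_cast card_progressions_le (k := k) (n := n) (by omega)
  obtain ⟨μ, hμ⟩ : ∃ μ, μ = mean k n p := ⟨_, rfl⟩
  have hμN : μ = #(progressions k n) * (p : ℝ) ^ k := by rw [hμ, mean_eq]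
  rw [← hμ, ← hM, ← hℓ] at hreg
  rw [← hμ] at h1
  rw [← hμ, ← hM]
  have hμ0 : 0 < μ := by
    by_contra! h
    nlinarith
  obtain ⟨hr1, hr2⟩ := poisson_range hμ0 hε hℓ0 (by linarith) hMa hMb h1 hreg
  have hℓu : ℓ ≤ Real.log n :=
    log_inv_le_log hk (by omega) hNup hℓ0 (by rw [hμN, hpℓ]) hr2 hu3
  have hμℓ : μ ≤ 4 * ℓ ^ 2 := le_trans (by nlinarith) hr1
  have hμlow : (n : ℝ) ^ 2 * (p : ℝ) ^ k ≤ 16 * k * μ := by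
    rw [one_div_mul_eq_div, div_le_iff₀ (by positivity)] at hNlow
    rw [hμN]
    calc (n : ℝ) ^ 2 * (p : ℝ) ^ k ≤ #(progressions k n) * (16 * k) * (p : ℝ) ^ k := by gcongr
      _ = _ := by ring
  have hphalf : (p : ℝ) ≤ 1 / 2 := by
    by_contra! hcon
    have hℓ1 : ℓ ≤ 1 := by
      have := Real.log_le_sub_one_of_pos (show 0 < 1 / (p : ℝ) by positivity)
      have h2 : 1 / (p : ℝ) ≤ 2 := by rw [div_le_iff₀ hp]; linarith
      linarith
    have h3 : (1 / 2 : ℝ) ^ k ≤ (p : ℝ) ^ k := by gcongr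
    have h4 : (n : ℝ) ^ 2 * (1 / 2 : ℝ) ^ k ≤ 64 * k := by
      calc (n : ℝ) ^ 2 * (1 / 2 : ℝ) ^ k ≤ (n : ℝ) ^ 2 * (p : ℝ) ^ k := by gcongr
        _ ≤ 16 * k * μ := hμlow
        _ ≤ 16 * k * (4 * 1) := by gcongr; nlinarith
        _ = _ := by ring
    rw [one_div, inv_pow, ← div_eq_mul_inv, div_le_iff₀ (by positivity)] at h4
    have h5 : 64 * (k : ℝ) * 2 ^ k + 2 * k ≤ n := by exact_mod_cast hnk
    nlinarith
  obtain ⟨m, hm⟩ : ∃ m : ℕ, m = ⌈(1 + ε) * μ⌉₊ := ⟨_, rfl⟩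
  have hmlow : (1 + ε) * μ ≤ m := by rw [hm]; exact Nat.le_ceil _
  have hmup : (m : ℝ) ≤ 2 * ((1 + ε) * μ) := by
    rw [hm]
    have := Nat.ceil_lt_add_one (show 0 ≤ (1 + ε) * μ by linarith)
    linarith
  have hm0 : 0 < m := by
    have : (0 : ℝ) < m := by linarith
    exact_mod_cast this
  have hm8 : (m : ℝ) ≤ 8 * ℓ ^ 2 := by linarith
  have hcond : 6 * k ^ 4 * k ^ 2 * (n * k ^ 2) * m ^ 2 ≤ #(progressions k n) := by
    have : (6 * k ^ 4 * k ^ 2 * (n * k ^ 2) * m ^ 2 : ℝ) ≤ #(progressions k n) := by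
      refine le_trans ?_ hNlow
      calc (6 * k ^ 4 * k ^ 2 * (n * k ^ 2) * m ^ 2 : ℝ)
          ≤ 6 * k ^ 4 * k ^ 2 * (n * k ^ 2) * (8 * ℓ ^ 2) ^ 2 := by gcongr
        _ = 1 / (16 * k) * (6144 * k ^ 9 * ℓ ^ 4) * n := by field_simp; ring
        _ ≤ 1 / (16 * k) * (6144 * k ^ 9 * Real.log n ^ 4) * n := by gcongr
        _ ≤ 1 / (16 * k) * n * n := by gcongr
        _ = _ := by ring
    exact_mod_cast this
  have hV := fun (e : Finset ℕ) (he : e ∈ progressions k n) => subset_of_mem_progressions he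
  have hcard := fun (e : Finset ℕ) (he : e ∈ progressions k n) => card_of_mem_progressions he
  have hcodeg := fun (x y : ℕ) (hxy : x ≠ y) => codegree_progressions_le k n hxy
  have hdeg : ∀ x, #((progressions k n).filter (x ∈ ·)) ≤ n * k ^ 2 := fun x => by
    have := card_filter_mem_le hV hcard (by omega) hcodeg x
    rwa [Nat.card_Icc, Nat.add_sub_cancel] at this
  have hmain := pow_mul_exp_le_binExp hp.le hphalf hV hcard hk hcodeg (by positivity) hdeg hcond
  rw [← hμN] at hmain
  have hE1 : ((k * m : ℕ) : ℝ) * (n * k ^ 2 : ℕ) * (p : ℝ) ^ (k - 1) ≤ 1 := by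
    have hpk : (p : ℝ) ^ k = p * (p : ℝ) ^ (k - 1) := by
      rw [← pow_succ', Nat.sub_add_cancel (by omega)]
    have hnp : 0 < n * (p : ℝ) := by positivity
    -- Since `μ ≤ n ^ 2 * p ^ 3` and `μ ≥ 1 / (4 * ℓ)`, the product `n * p` is at least the cube
    -- root of `n / (4 * ℓ)`, beating any power of `ℓ ≤ log n`. The term to be bounded is
    -- polylogarithmic divided by `n * p`.
    have hcube : (512 * (k : ℝ) ^ 4 * ℓ ^ 4) ^ 3 ≤ (n * (p : ℝ)) ^ 3 := by
      have b1 : n * μ ≤ (n * (p : ℝ)) ^ 3 := by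
        have b2 : (p : ℝ) ^ k ≤ (p : ℝ) ^ 3 := pow_le_pow_of_le_one hp.le hp1.le hk
        rw [hμN]
        calc n * (#(progressions k n) * (p : ℝ) ^ k) ≤ n * ((n : ℝ) ^ 2 * (p : ℝ) ^ 3) := by gcongr
          _ = _ := by ring
      refine le_trans ?_ b1
      refine le_of_mul_le_mul_left ?_ (show 0 < 4 * ℓ by positivity)
      calc 4 * ℓ * (512 * (k : ℝ) ^ 4 * ℓ ^ 4) ^ 3 = 4 * (512 * k ^ 4) ^ 3 * ℓ ^ 13 := by ring
        _ ≤ 4 * (512 * k ^ 4) ^ 3 * Real.log n ^ 13 := by gcongr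
        _ ≤ n := hn2
        _ ≤ n * (4 * ℓ * μ) := le_mul_of_one_le_right (by linarith) hr2
        _ = _ := by ring
    have hroot : 512 * (k : ℝ) ^ 4 * ℓ ^ 4 ≤ n * (p : ℝ) :=
      le_of_pow_le_pow_left₀ three_ne_zero hnp.le hcube
    refine le_of_mul_le_mul_left ?_ hnp
    push_cast
    calc n * (p : ℝ) * (k * m * (n * k ^ 2) * (p : ℝ) ^ (k - 1))
        = k ^ 3 * m * ((n : ℝ) ^ 2 * (p : ℝ) ^ k) := by rw [hpk]; ring
      _ ≤ k ^ 3 * (8 * ℓ ^ 2) * (16 * k * (4 * ℓ ^ 2)) := by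
          refine mul_le_mul (by gcongr) (hμlow.trans ?_) (by positivity) (by positivity)
          gcongr
      _ = 512 * (k : ℝ) ^ 4 * ℓ ^ 4 := by ring
      _ ≤ n * (p : ℝ) := hroot
      _ = n * (p : ℝ) * 1 := (mul_one _).symm
  have hE2 : ((k * m : ℕ) : ℝ) ^ 2 * (k ^ 2 : ℕ) * (p : ℝ) ≤ 1536 * (k : ℝ) ^ 4 := by
    have b1 : ℓ ^ 4 * (p : ℝ) ≤ 24 := by
      have b2 := Real.pow_div_factorial_le_exp ℓ hℓ0.le 4
      rw [hpℓ, Real.exp_neg, ← div_eq_mul_inv, div_le_iff₀ (Real.exp_pos _)]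
      have b3 : ((Nat.factorial 4 : ℕ) : ℝ) = 24 := by norm_num [Nat.factorial]
      rw [b3] at b2
      linarith
    push_cast
    calc ((k : ℝ) * m) ^ 2 * k ^ 2 * p ≤ (k * (8 * ℓ ^ 2)) ^ 2 * k ^ 2 * p := by gcongr
      _ = 64 * k ^ 4 * (ℓ ^ 4 * p) := by ring
      _ ≤ 64 * k ^ 4 * 24 := by gcongr
      _ = _ := by ring
  refine (exp_neg_le_poisson hμ0 hε hMa hMb hM1 (by positivity) h1 hmup hm0).trans ?_
  have hexp : Real.exp (-(2 * (μ + (1 + 1536 * (k : ℝ) ^ 4)))) ≤ Real.exp (-(2 * (μ +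
      ((k * m : ℕ) : ℝ) * (n * k ^ 2 : ℕ) * (p : ℝ) ^ (k - 1) +
      ((k * m : ℕ) : ℝ) ^ 2 * (k ^ 2 : ℕ) * (p : ℝ)))) :=
    Real.exp_le_exp.2 (by linarith)
  refine (mul_le_mul_of_nonneg_left hexp (by positivity)).trans (hmain.trans ?_)
  rw [upperTail_eq]
  refine binExp_mono hp.le hp1.le fun S _ => ?_
  split_ifs with a b
  · exact le_rfl
  · refine absurd (le_trans ?_ (Nat.cast_le.2 a)) b
    rwa [← hμ]
  · exact zero_le_one
  · exact le_rfl

end LowerTail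

end RandomAP

end

/-! ### The main theorem -/

theorem mainTheorem3 (k : ℕ) (hk : 3 ≤ k) :
    ∃ n₀ : ℕ, ∃ b B : ℝ, 0 < n₀ ∧ 0 < b ∧ 0 < B ∧
      ∀ n : ℕ, n₀ ≤ n → ∀ p : unitInterval, 0 < (p : ℝ) → ∀ ε : ℝ, 0 < ε →
        (if 1 ≤ (1 + ε) * RandomAP.mean k n p ∧
            (1 + ε) * RandomAP.mean k n p ≤ (RandomAP.count k n (Set.Icc 1 n) : ℝ)
          then (1 : ℝ) else 0) * Real.exp (-(B * max 1 (ε ^ 2)) * RandomAP.Phi k n p)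
            ≤ RandomAP.upperTail k n p ε ∧
        RandomAP.upperTail k n p ε
          ≤ Real.exp (-(b * min (ε ^ 3) (√ε)) * RandomAP.Phi k n p) := by
  have hk0 : (3 : ℝ) ≤ k := by exact_mod_cast hk
  obtain ⟨b, hb, hupper⟩ := RandomAP.exists_upperTail_le k hk
  obtain ⟨n₁, B, hB, hlower⟩ := RandomAP.exists_exp_neg_le_upperTail k hk
  refine ⟨max n₁ (2 * k), b, max B (2 * (6 * k + 1)), lt_max_of_lt_right (by omega), hb,
    lt_max_of_lt_left hB, fun n hn p hp ε hε =>
      ⟨?_, hupper n ((le_max_right _ _).trans hn) p hp ε hε⟩⟩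
  have hnonneg : 0 ≤ RandomAP.upperTail k n p ε := measureReal_nonneg
  split_ifs with h
  swap
  · simpa using hnonneg
  rw [one_mul]
  obtain ⟨h1, h2⟩ := h
  rw [RandomAP.count_Icc] at h2
  have hμ0 : 0 < RandomAP.mean k n p := by
    by_contra! h
    nlinarith
  rcases p.2.2.eq_or_lt with hp1 | hp1
  -- For `p = 1` the mean is already the total number of progressions, so the indicator vanishes.
  · rw [RandomAP.mean_eq, hp1, one_pow, mul_one] at h2 hμ0
    nlinarith
  set μ := RandomAP.mean k n p with hμ
  set ℓ := Real.log (1 / (p : ℝ)) with hℓ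
  have hℓ0 : 0 < ℓ := Real.log_pos (one_lt_one_div hp hp1)
  have hΦ : RandomAP.Phi k n p = min μ (√μ * ℓ) := rfl
  rw [hΦ]
  set M := max 1 (ε ^ 2) with hM
  have hM1 : 1 ≤ M := le_max_left _ _
  have hMε : ε ^ 2 ≤ M := le_max_right _ _
  have hBK := le_max_right B (2 * (6 * (k : ℝ) + 1))
  have hBB := le_max_left B (2 * (6 * (k : ℝ) + 1))
  set B' := max B (2 * (6 * (k : ℝ) + 1))
  have hB' : 0 < B' := hB.trans_le hBB
  have hinterval := RandomAP.exp_neg_sqrt_le_upperTail (by omega) hp h1 h2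
  by_cases hcase : √((1 + ε) * μ) * ℓ ≤ 2 * (M * min μ (√μ * ℓ))
  · refine le_trans (Real.exp_le_exp.2 ?_) hinterval
    rw [neg_mul, neg_le_neg_iff]
    calc (6 * k + 1) * √((1 + ε) * μ) * ℓ = (6 * k + 1) * (√((1 + ε) * μ) * ℓ) := mul_assoc _ _ _
      _ ≤ (6 * k + 1) * (2 * (M * min μ (√μ * ℓ))) := by gcongr
      _ = 2 * (6 * k + 1) * (M * min μ (√μ * ℓ)) := by ring
      _ ≤ B' * (M * min μ (√μ * ℓ)) := by gcongr
      _ = _ := by ring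
  -- By this inequality the interval suffices whenever `Φ = √μ * ℓ`. Hence `Φ = μ`, which is the
  -- range of the Poisson-type bound.
  · have hsqrt : √((1 + ε) * μ) ≤ 2 * M * √μ := by
      rw [Real.sqrt_mul (by linarith)]
      gcongr
      rw [Real.sqrt_le_left (by linarith)]
      nlinarith [sq_nonneg (ε - 1)]
    have hmin : min μ (√μ * ℓ) = μ := by
      by_contra hne
      have : min μ (√μ * ℓ) = √μ * ℓ := (min_choice _ _).resolve_left hne
      rw [this] at hcase
      exact hcase (by calc _ ≤ 2 * M * √μ * ℓ := by gcongr
                        _ = _ := by ring)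
    rw [hmin] at hcase ⊢
    have hMμ : 0 < M * μ := by positivity
    refine le_trans (Real.exp_le_exp.2 ?_)
      (hlower n ((le_max_left _ _).trans hn) p hp hp1 ε hε h1 (by linarith))
    rw [neg_mul, neg_le_neg_iff]
    gcongr
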